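/- Fix a dimension $d\ge 1$ and write points of $\mathbb R^{d+1}=\mathbb R^d\times\mathbb R$ as $(x,t)$ (physical side) or $(\xi,\eta)$ (frequency side); $\widehat g(\xi,\eta)=\int g(x,t)e^{-2\pi i(x\cdot\xi+t\eta)}\,dx\,dt$, and ${}^\vee$ is the inverse transform. For $1\le q,r\le\infty$ and an interval $I$ let $\|f\|_{L^q_tL^r_x(\mathbb R^d\times I)}=\big(\int_I(\int_{\mathbb R^d}|f(x,t)|^r\,dx)^{q/r}dt\big)^{1/q}$ (essential suprema for infinite exponents), and for a weight $w=w(t)\ge0$ let $\|f\|_{L^q_tL^r_x(\mathbb R^d\times w)}=\|fw\|_{L^q_tL^r_x(\mathbb R^d\times\mathbb R)}$. For $\delta>0$ and $\omega\in\mathbb R^d$ let $\theta_{\omega}=\{(\xi,\eta): |\xi_i-\omega_i|\le\delta\ (1\le i\le d),\ |\eta-2\omega\cdot(\xi-\omega)-|\omega|^2|\le 2d\delta^2\}$, let $2\theta_\omega$ be its dilate by $2$ about its centre $(\omega,|\omega|^2)$, and let $A_{\omega}(\xi,\eta)=\big(\tfrac{\xi-\omega}{\delta},\tfrac{\eta-2\omega\cdot(\xi-\omega)-|\omega|^2}{2d\delta^2}\big)$,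 so that $A_\omega\theta_\omega=[-1,1]^{d+1}$. Fix a Schwartz function $\chi$ on $\mathbb R^{d+1}$ with $\chi=1$ on $[-1,1]^{d+1}$ and $\chi=0$ outside $[-2,2]^{d+1}$, and put $\widetilde P_{\theta_\omega}g=(\widehat g\cdot(\chi\circ A_\omega))^\vee$. Fix also an even Schwartz function $\phi:\mathbb R\to\mathbb R$ with $\phi\ge 1_{[-1,1]}$ and $\operatorname{supp}\widehat\phi\subset[-1,1]$, and let $\phi_{[0,\delta^{-2}]}(t)=\phi\big((t-\tfrac12\delta^{-2})/\delta^{-2}\big)$. Let $c=100\sqrt d$. For a $c\delta$-separated set $\Xi\subset[-1,1]^d$ (distinct points are at distance at least $c\delta$) let $\widetilde D_{q,r}(\delta,\Xi)$ and $\overline D_{q,r}(\delta,\Xi)$ be the best constants in $$\Big\|\sum_{\omega\in\Xi}\widetilde P_{\theta_\omega}g\Big\|_{L^q_tL^r_x(\mathbb R^d\times\mathbb R)}\le \widetilde D_{q,r}(\delta,\Xi)\Big(\sum_{\omega\in\Xi}\|\widetilde P_{\theta_\omega}g\|^2_{L^q_tL^r_x(\mathbb R^d\times\mathbb R)}\Big)^{1/2},$$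 $$\Big\|\sum_{\omega\in\Xi}\widetilde P_{\theta_\omega}g\Big\|_{L^q_tL^r_x(\mathbb R^d\times[0,\delta^{-2}])}\le \overline D_{q,r}(\delta,\Xi)\Big(\sum_{\omega\in\Xi}\|\widetilde P_{\theta_\omega}g\|^2_{L^q_tL^r_x(\mathbb R^d\times\phi_{[0,\delta^{-2}]})}\Big)^{1/2}$$ over all Schwartz functions $g$ with $\widehat g$ supported in $\bigcup_{\omega\in\Xi}2\theta_\omega$, and let $\widetilde D_{q,r}(\delta)$, $\overline D_{q,r}(\delta)$ be the suprema of these constants over all $c\delta$-separated $\Xi\subset[-1,1]^d$. Write $X\lesssim_A Y$ if $X\le CY$ with a finite constant $C$ depending only on $A$, on $d$ and on the fixed functions $\chi,\phi$ (in particular not on $\delta$, and not on $q,r$ unless they are listed in $A$). Then for all $0<\delta<1$ and all $1\le r\le\infty$: (1) if $2\le q\le\infty$, then $\overline D_{q,r}(\delta)\lesssim\widetilde D_{q,r}(2\delta)$ and $\widetilde D_{q,r}(\delta)\lesssim_q\overline D_{q,r}(\delta)$; (2) if $1\le\tilde q<q\le\infty$, then $\overline D_{\tilde q,r}(\delta)\lesssim_{\tilde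 q,q}\overline D_{q,r}(\delta)$; (3) if $2\le\tilde q<q\le\infty$, then $\widetilde D_{\tilde q,r}(\delta)\lesssim_{\tilde q,q}\widetilde D_{q,r}(2\delta)$, where the constant does not depend on $\phi$. -/

import Mathlib

open MeasureTheory
open scoped ENNReal NNReal FourierTransform SchwartzMap RealInnerProductSpace

noncomputable section

namespace MixedDecoupling

/-- The spatial domain `ℝ^d` with its Euclidean norm. -/
abbrev Space (d : ℕ) : Type := EuclideanSpace ℝ (Fin d)

/-- Space-time `ℝ^{d+1} = ℝ^d × ℝ` with its Euclidean structure; points are `(x, t)` on the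
physical side and `(ξ, η)` on the frequency side. -/
abbrev SpaceTime (d : ℕ) : Type := WithLp 2 (Space d × ℝ)

/-- The point `(x, t)` of space-time. -/
def pt {d : ℕ} (x : Space d) (t : ℝ) : SpaceTime d := WithLp.toLp 2 (x, t)

/-- The mixed norm `‖f‖_{L^q_t L^r_x(ℝ^d × I)}`, as an extended nonnegative real.
For `q = ∞` or `r = ∞` the norm in that variable is the essential supremum. -/
def mixedNorm {d : ℕ} (q r : ℝ≥0∞) (I : Set ℝ) (f : SpaceTime d → ℂ) : ℝ≥0∞ :=
  eLpNorm (fun t : ℝ => eLpNorm (fun x : Space d => f (pt x t)) r volume) q (volume.restrict I)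

/-- The weighted mixed norm `‖f‖_{L^q_t L^r_x(ℝ^d × w)} = ‖f w‖_{L^q_t L^r_x(ℝ^d × ℝ)}`
for a weight `w` depending on time only. -/
def weightedMixedNorm {d : ℕ} (q r : ℝ≥0∞) (w : ℝ → ℝ) (f : SpaceTime d → ℂ) : ℝ≥0∞ :=
  mixedNorm q r Set.univ (fun p => f p * (w p.snd : ℂ))

/-- The `κ`-fold dilate `κ θ_ω`, about its centre `(ω, |ω|²)`, of the parallelepiped
`θ_ω = {(ξ, η) : |ξ_i - ω_i| ≤ δ, |η - 2 ω · (ξ - ω) - |ω|²| ≤ 2 d δ²}`. -/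
def plank {d : ℕ} (κ δ : ℝ) (ω : Space d) : Set (SpaceTime d) :=
  {p | (∀ i, |p.fst i - ω i| ≤ κ * δ) ∧
    |p.snd - 2 * ⟪ω, p.fst - ω⟫ - ‖ω‖ ^ 2| ≤ κ * (2 * d * δ ^ 2)}

/-- The affine map `A_ω` taking `θ_ω` onto the cube `[-1, 1]^{d+1}`. -/
def rescale {d : ℕ} (δ : ℝ) (ω : Space d) (p : SpaceTime d) : SpaceTime d :=
  pt (δ⁻¹ • (p.fst - ω)) ((p.snd - 2 * ⟪ω, p.fst - ω⟫ - ‖ω‖ ^ 2) / (2 * d * δ ^ 2))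

/-- The cube `[-a, a]^{d+1}`. -/
def cube (d : ℕ) (a : ℝ) : Set (SpaceTime d) :=
  {p | (∀ i, |p.fst i| ≤ a) ∧ |p.snd| ≤ a}

/-- `χ` equals `1` on `[-1, 1]^{d+1}` and vanishes outside `[-2, 2]^{d+1}`. -/
def IsCutoff {d : ℕ} (χ : 𝓢(SpaceTime d, ℂ)) : Prop :=
  (∀ p ∈ cube d 1, χ p = 1) ∧ ∀ p ∉ cube d 2, χ p = 0

/-- The smoothed Fourier projection `g ↦ (ĝ · (χ ∘ A_ω))^∨`. -/
def smoothProj {d : ℕ} (χ : 𝓢(SpaceTime d, ℂ)) (δ : ℝ) (ω : Space d)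
    (g : SpaceTime d → ℂ) : SpaceTime d → ℂ :=
  𝓕⁻ (fun p => 𝓕 g p * χ (rescale δ ω p))

/-- `Ξ` is a `cδ`-separated subset of `[-1, 1]^d`, where `c = 100 √d`.
(Such sets are finite as soon as `d ≥ 1` and `δ > 0`.) -/
def IsAdmissible {d : ℕ} (δ : ℝ) (Ξ : Finset (Space d)) : Prop :=
  (∀ ω ∈ Ξ, ∀ i, |ω i| ≤ 1) ∧
    ∀ ω ∈ Ξ, ∀ ω' ∈ Ξ, ω ≠ ω' → 100 * √(d : ℝ) * δ ≤ dist ω ω'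

/-- The Fourier transform of `g` is supported in `⋃_{ω ∈ Ξ} 2 θ_ω`. -/
def HasFourierSupport {d : ℕ} (δ : ℝ) (Ξ : Finset (Space d)) (g : SpaceTime d → ℂ) : Prop :=
  Function.support (𝓕 g) ⊆ ⋃ ω ∈ Ξ, plank 2 δ ω

/-- The best constant in the global smoothed decoupling inequality for the family `Ξ`. -/
def globalConstOn {d : ℕ} (χ : 𝓢(SpaceTime d, ℂ)) (q r : ℝ≥0∞) (δ : ℝ)
    (Ξ : Finset (Space d)) : ℝ≥0∞ :=
  sInf {C : ℝ≥0∞ | ∀ g : 𝓢(SpaceTime d, ℂ), HasFourierSupport δ Ξ g →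
    mixedNorm q r Set.univ (fun p => ∑ ω ∈ Ξ, smoothProj χ δ ω g p) ≤
      C * (∑ ω ∈ Ξ, mixedNorm q r Set.univ (smoothProj χ δ ω g) ^ 2) ^ (1 / 2 : ℝ)}

/-- The global smoothed decoupling constant: supremum over all `cδ`-separated families. -/
def globalConst {d : ℕ} (χ : 𝓢(SpaceTime d, ℂ)) (q r : ℝ≥0∞) (δ : ℝ) : ℝ≥0∞ :=
  ⨆ (Ξ : Finset (Space d)) (_ : IsAdmissible δ Ξ), globalConstOn χ q r δ Ξ

/-- `φ` is an even Schwartz function with `φ ≥ 1_{[-1, 1]}` whose Fourier transform is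
supported in `[-1, 1]`. -/
def IsTimeWeight (φ : 𝓢(ℝ, ℝ)) : Prop :=
  (∀ t, φ (-t) = φ t) ∧ (∀ t, Set.indicator (Set.Icc (-1) 1) 1 t ≤ φ t) ∧
    Function.support (𝓕 (fun t : ℝ => (φ t : ℂ))) ⊆ Set.Icc (-1) 1

/-- `φ_I(t) = φ((t - c_I) / |I|)` for the interval `I = [a, b]` with centre `c_I`. -/
def adapted (φ : 𝓢(ℝ, ℝ)) (a b : ℝ) (t : ℝ) : ℝ := φ ((t - (a + b) / 2) / (b - a))

/-- The best constant in the smoothed decoupling inequality localized to times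
`[0, δ⁻²]`, for the family `Ξ`. -/
def localConstOn {d : ℕ} (χ : 𝓢(SpaceTime d, ℂ)) (φ : 𝓢(ℝ, ℝ)) (q r : ℝ≥0∞) (δ : ℝ)
    (Ξ : Finset (Space d)) : ℝ≥0∞ :=
  sInf {C : ℝ≥0∞ | ∀ g : 𝓢(SpaceTime d, ℂ), HasFourierSupport δ Ξ g →
    mixedNorm q r (Set.Icc 0 (δ ^ 2)⁻¹) (fun p => ∑ ω ∈ Ξ, smoothProj χ δ ω g p) ≤
      C * (∑ ω ∈ Ξ,
        weightedMixedNorm q r (adapted φ 0 (δ ^ 2)⁻¹) (smoothProj χ δ ω g) ^ 2) ^ (1 / 2 : ℝ)}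

/-- The time-localized smoothed decoupling constant: supremum over all `cδ`-separated
families. -/
def localConst {d : ℕ} (χ : 𝓢(SpaceTime d, ℂ)) (φ : 𝓢(ℝ, ℝ)) (q r : ℝ≥0∞) (δ : ℝ) : ℝ≥0∞ :=
  ⨆ (Ξ : Finset (Space d)) (_ : IsAdmissible δ Ξ), localConstOn χ φ q r δ Ξ

end MixedDecoupling

end

/-! Write `f_ω` for the smoothed pieces and `F` for their sum. Everything rests on two effects of
the weight `φ` adapted to `[0, δ⁻²]`: it is at least 1 on that interval, and multiplying by it only
blurs the time frequency by `δ²`, so `f_ω φ` stays in a plank of thickness comparable to `δ²`.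

Local by global: on the interval `|F| ≤ |F φ|`, and each `f_ω φ` has spectrum in `θ_ω` at scale
`2δ`, where the projection is the identity. The frequencies are only `cδ`-separated, so they are
split into boundedly many `2cδ`-separated colour classes (`two_mul_le_dist_of_cellColor_eq`,
`smoothProj_sum_weightMul`).

Global by local: tile time by translates of `[0, δ⁻²]`, apply the local inequality on each tile, and
sum in `ℓ^q`. For `q ≥ 2` Minkowski moves the `ℓ²` sum outside (`eLpNorm_ell2_le`), and the
translated weights have bounded sum.

Lowering the exponent locally: Hölder in time on an interval of length `δ⁻²` loses exactly the power
of `δ` that Bernstein (`exists_bernstein_const`) gains on each `f_ω φ`. Bernstein holds because such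
a piece is an average of its translates along `(-2ω, 1)` at scale `δ⁻²`, and spatial translations do
not affect `L^r_x`; hence uniformity in `r`.

Lowering it globally chains these three bounds for one fixed auxiliary weight. -/

noncomputable section

namespace MixedDecoupling

/-! ### Minkowski's integral inequality -/

/-- Minkowski's integral inequality for nonnegative functions. -/
theorem eLpNorm_lintegral_le {α β : Type*} [MeasurableSpace α] [MeasurableSpace β]
    {μ : Measure α} {ν : Measure β} [SigmaFinite μ] [SigmaFinite ν] {f : α → β → ℝ≥0∞}
    (hf : Measurable (Function.uncurry f)) {r : ℝ≥0∞} (hr : 1 ≤ r)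
    (hN : Measurable fun s => eLpNorm (fun x => f x s) r μ) :
    eLpNorm (fun x => ∫⁻ s, f x s ∂ν) r μ ≤ ∫⁻ s, eLpNorm (fun x => f x s) r μ ∂ν := by
  rcases eq_or_ne r ∞ with rfl | hr_top
  · simp only [eLpNorm_exponent_top] at hN ⊢
    refine essSup_le_of_ae_le _ ?_
    have hset : MeasurableSet
        {p : α × β | f p.1 p.2 ≤ eLpNormEssSup (fun x => f x p.2) μ} :=
      measurableSet_le hf (hN.comp measurable_snd)
    have h1 : ∀ᵐ s ∂ν, ∀ᵐ x ∂μ, f x s ≤ eLpNormEssSup (fun x => f x s) μ :=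
      Filter.Eventually.of_forall fun s => by
        simpa using enorm_ae_le_eLpNormEssSup (fun x => f x s) μ
    have h2 : ∀ᵐ x ∂μ, ∀ᵐ s ∂ν, f x s ≤ eLpNormEssSup (fun x => f x s) μ :=
      (Measure.ae_ae_comm (p := fun s x => f x s ≤ eLpNormEssSup (fun x => f x s) μ)
        (measurable_swap hset)).1 h1
    filter_upwards [h2] with x hx
    simpa using lintegral_mono_ae hx
  have hr0 : r ≠ 0 := (zero_lt_one.trans_le hr).ne'
  obtain ⟨a, ha1, rfl⟩ : ∃ a : ℝ, 1 ≤ a ∧ r = ENNReal.ofReal a :=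
    ⟨r.toReal, by simpa using ENNReal.toReal_mono hr_top hr, (ENNReal.ofReal_toReal hr_top).symm⟩
  have ha0 : 0 < a := by linarith
  have hnorm : ∀ h : α → ℝ≥0∞,
      eLpNorm h (ENNReal.ofReal a) μ = (∫⁻ x, h x ^ a ∂μ) ^ (1 / a) := fun h => by
    rw [eLpNorm_eq_lintegral_rpow_enorm_toReal hr0 hr_top, ENNReal.toReal_ofReal ha0.le]
    simp
  simp only [hnorm] at hN ⊢
  rcases ha1.eq_or_lt with rfl | ha
  · simp only [ENNReal.rpow_one, div_one]
    rw [lintegral_lintegral_swap hf.aemeasurable]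
  set F : α → ℝ≥0∞ := fun x => ∫⁻ s, f x s ∂ν with hF
  set G : ℝ≥0∞ := ∫⁻ s, (∫⁻ x, f x s ^ a ∂μ) ^ (1 / a) ∂ν with hG
  have hFm : Measurable F := hf.lintegral_prod_right
  -- Truncations of `F` with finite `L^a` norm: the duality argument ends by dividing by a power of
  -- that norm.
  set H : ℕ → α → ℝ≥0∞ := fun n => (spanningSets μ n).indicator fun x => min (F x) n with hH
  have hHm : ∀ n, Measurable (H n) := fun n =>
    (hFm.min measurable_const).indicator (measurableSet_spanningSets μ n)
  have hHF : ∀ n x, H n x ≤ F x := fun n x =>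
    Set.indicator_le' (fun _ _ => min_le_left _ _) (fun _ _ => zero_le) x
  have hfin : ∀ n, ∫⁻ x, H n x ^ a ∂μ ≠ ∞ := fun n => by
    have : ∀ x, H n x ^ a ≤ (spanningSets μ n).indicator (fun _ => (n : ℝ≥0∞) ^ a) x := by
      intro x
      by_cases hx : x ∈ spanningSets μ n
      · simp only [hH, hx, Set.indicator_of_mem]
        exact ENNReal.rpow_le_rpow (min_le_right _ _) ha0.le
      · simp [hH, hx, ha0]
    refine ((lintegral_mono this).trans_lt ?_).ne
    rw [lintegral_indicator_const (measurableSet_spanningSets μ n)]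
    exact ENNReal.mul_lt_top (by finiteness) (measure_spanningSets_lt_top μ n)
  have hconj : a.HolderConjugate (a / (a - 1)) := Real.HolderConjugate.conjExponent ha
  have hkey : ∀ n, (∫⁻ x, H n x ^ a ∂μ) ≤ G ^ a := fun n => by
    set A := ∫⁻ x, H n x ^ a ∂μ with hA
    rcases eq_or_ne A 0 with h0 | h0
    · simp [h0]
    have hp : ∀ x, (H n x ^ (a - 1)) ^ (a / (a - 1)) = H n x ^ a := fun x => by
      rw [← ENNReal.rpow_mul]; congr 1; field_simp [show a - 1 ≠ 0 by linarith]
    -- Test `F` against `H n ^ (a - 1)`: Tonelli, then Hölder in `x` for each fixed `s`.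
    have h1 : A ≤ G * A ^ (1 / (a / (a - 1))) := by
      calc A ≤ ∫⁻ x, F x * H n x ^ (a - 1) ∂μ := by
            refine lintegral_mono fun x => ?_
            calc H n x ^ a = H n x ^ (1 + (a - 1)) := by ring_nf
              _ = H n x * H n x ^ (a - 1) := by
                rw [ENNReal.rpow_add_of_nonneg _ _ zero_le_one (by linarith), ENNReal.rpow_one]
              _ ≤ _ := by gcongr; exact hHF n x
        _ = ∫⁻ x, ∫⁻ s, f x s * H n x ^ (a - 1) ∂ν ∂μ := by
            refine lintegral_congr fun x => ?_
            exact (lintegral_mul_const _ (hf.comp measurable_prodMk_left)).symm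
        _ = ∫⁻ s, ∫⁻ x, f x s * H n x ^ (a - 1) ∂μ ∂ν := by
            refine lintegral_lintegral_swap (Measurable.aemeasurable ?_)
            exact hf.mul (((hHm n).pow_const _).comp measurable_fst)
        _ ≤ ∫⁻ s, (∫⁻ x, f x s ^ a ∂μ) ^ (1 / a) * A ^ (1 / (a / (a - 1))) ∂ν := by
            refine lintegral_mono fun s => ?_
            have := ENNReal.lintegral_mul_le_Lp_mul_Lq μ hconj
              (f := fun x => f x s) (g := fun x => H n x ^ (a - 1))
              (hf.comp measurable_prodMk_right).aemeasurable
              ((hHm n).pow_const _).aemeasurable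
            simpa only [hp, Pi.mul_apply] using this
        _ = G * A ^ (1 / (a / (a - 1))) := by rw [lintegral_mul_const _ hN]
    have hexp : 1 / (a / (a - 1)) = 1 - 1 / a := by field_simp
    rw [hexp] at h1
    have h2 : A ^ (1 / a) ≤ G := by
      have hA1 : A = A ^ (1 / a) * A ^ (1 - 1 / a) := by
        rw [← ENNReal.rpow_add _ _ h0 (hfin n)]; simp
      have hne : A ^ (1 - 1 / a) ≠ 0 := (ENNReal.rpow_pos (pos_iff_ne_zero.2 h0) (hfin n)).ne'
      have hnt : A ^ (1 - 1 / a) ≠ ∞ := ENNReal.rpow_ne_top_of_ne_zero h0 (hfin n)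
      rw [hA1] at h1
      refine (ENNReal.mul_le_mul_iff_left hne hnt).1 (le_trans h1 ?_)
      rw [← hA1]
    calc A = (A ^ (1 / a)) ^ a := by rw [← ENNReal.rpow_mul]; simp [ha0.ne']
      _ ≤ G ^ a := ENNReal.rpow_le_rpow h2 ha0.le
  have hsup : ∀ x, F x ^ a ≤ ⨆ n, H n x ^ a := fun x => by
    obtain ⟨n₀, hn₀⟩ : ∃ n, x ∈ spanningSets μ n :=
      Set.mem_iUnion.1 (iUnion_spanningSets μ ▸ Set.mem_univ x)
    have hlim : Filter.Tendsto (fun n : ℕ => (min (F x) n) ^ a) Filter.atTop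
        (nhds ((min (F x) ∞) ^ a)) :=
      (ENNReal.continuous_rpow_const.tendsto _).comp
        (tendsto_const_nhds.min ENNReal.tendsto_nat_nhds_top)
    rw [min_top_right] at hlim
    refine le_of_tendsto hlim ?_
    filter_upwards [Filter.eventually_ge_atTop n₀] with n hn
    refine le_trans (le_of_eq ?_) (le_iSup _ n)
    simp [hH, monotone_spanningSets μ hn hn₀]
  have hmono : Monotone fun n x => H n x ^ a := by
    intro m n hmn x
    refine ENNReal.rpow_le_rpow ?_ ha0.le
    refine (Set.indicator_le_indicator ?_).trans
      (Set.indicator_le_indicator_of_subset (monotone_spanningSets μ hmn) (fun _ => zero_le) x)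
    exact min_le_min_left _ (by exact_mod_cast hmn)
  calc (∫⁻ x, F x ^ a ∂μ) ^ (1 / a) ≤ (G ^ a) ^ (1 / a) := by
        refine ENNReal.rpow_le_rpow ?_ (by positivity)
        calc ∫⁻ x, F x ^ a ∂μ ≤ ∫⁻ x, ⨆ n, H n x ^ a ∂μ := lintegral_mono hsup
          _ = ⨆ n, ∫⁻ x, H n x ^ a ∂μ := lintegral_iSup (fun n => (hHm n).pow_const _) hmono
          _ ≤ G ^ a := iSup_le hkey
    _ = G := by rw [← ENNReal.rpow_mul]; simp [ha0.ne']

/-! ### Spatial slice norms -/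

/-- The spatial norm `‖f(·, t)‖_{L^r(ℝ^d)}`. -/
def sliceNorm {d : ℕ} (r : ℝ≥0∞) (f : SpaceTime d → ℂ) (t : ℝ) : ℝ≥0∞ :=
  eLpNorm (fun x : Space d => f (pt x t)) r volume

theorem continuous_pt {d : ℕ} : Continuous fun z : Space d × ℝ => pt z.1 z.2 :=
  WithLp.prod_continuous_toLp 2 _ _

theorem continuous_slice {d : ℕ} {f : SpaceTime d → ℂ} (hf : Continuous f) (t : ℝ) :
    Continuous fun x : Space d => f (pt x t) :=
  hf.comp (continuous_pt.comp (by fun_prop : Continuous fun x : Space d => (x, t)))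

/-- Fatou's lemma makes the slice norm lower semicontinuous in time. This treats all exponents at
once, including `r = ∞`. -/
theorem measurable_sliceNorm {d : ℕ} (r : ℝ≥0∞) {f : SpaceTime d → ℂ} (hf : Continuous f) :
    Measurable (sliceNorm r f) := by
  refine LowerSemicontinuous.measurable fun t => ?_
  intro y hy
  by_contra hcon
  obtain ⟨u, hu, hle⟩ := Filter.exists_seq_forall_of_frequently (Filter.not_eventually.1 hcon)
  have := Lp.eLpNorm_lim_le_liminf_eLpNorm (p := r) (μ := (volume : Measure (Space d)))
    (f := fun n x => f (pt x (u n)))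
    (fun n => (continuous_slice hf (u n)).aestronglyMeasurable) (fun x => f (pt x t))
    (Filter.Eventually.of_forall fun x => ((hf.comp (continuous_pt.comp
      (by fun_prop : Continuous fun t : ℝ => (x, t)))).tendsto t).comp hu)
  refine absurd (hy.trans_le this) (not_lt.2 ?_)
  refine (Filter.liminf_le_liminf (Filter.Eventually.of_forall fun n => not_lt.1 (hle n))).trans ?_
  simp

/-! ### Fourier multipliers depending on one affine functional -/

section Fourier

variable {V : Type*} [NormedAddCommGroup V] [InnerProductSpace ℝ V] [FiniteDimensional ℝ V]
  [MeasurableSpace V] [BorelSpace V]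

/-- Multiplying by a Schwartz function of an affine functional superposes translates of the
Fourier transform along a line. -/
theorem fourier_mul_comp_affine {f : V → ℂ} (hf : Integrable f) (b : 𝓢(ℝ, ℂ)) (v₀ : V) (c₀ : ℝ)
    (p : V) :
    𝓕 (fun ζ => f ζ * b (⟪v₀, ζ⟫ + c₀)) p =
      ∫ s : ℝ, 𝓕 b s * (Real.fourierChar (s * c₀) : ℂ) * 𝓕 f (p - s • v₀) := by
  have hb : ∀ y : ℝ, b y = ∫ s : ℝ, (Real.fourierChar (s * y) : ℂ) * 𝓕 b s := fun y => by
    conv_lhs => rw [← FourierTransform.fourierInv_fourier_eq (F := 𝓢(ℝ, ℂ)) b]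
    rw [SchwartzMap.fourierInv_coe, Real.fourierInv_eq]
    simp [Circle.smul_def, mul_comm]
  have hint : Integrable (Function.uncurry fun (ζ : V) (s : ℝ) =>
      (Real.fourierChar (-⟪ζ, p⟫) : ℂ) * (f ζ * ((Real.fourierChar (s * (⟪v₀, ζ⟫ + c₀)) : ℂ) *
        𝓕 b s))) (volume.prod volume) := by
    have h1 : Integrable (fun z : V × ℝ => f z.1 * 𝓕 b z.2) (volume.prod volume) :=
      hf.mul_prod (𝓕 b).integrable
    have h2 : Integrable (fun z : V × ℝ => ((Real.fourierChar (-⟪z.1, p⟫) : ℂ) *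
        (Real.fourierChar (z.2 * (⟪v₀, z.1⟫ + c₀)) : ℂ)) * (f z.1 * 𝓕 b z.2))
        (volume.prod volume) := by
      refine h1.bdd_mul (c := 1) (Continuous.aestronglyMeasurable ?_)
        (Filter.Eventually.of_forall fun z => by simp only [norm_mul, Circle.norm_coe, mul_one, le_refl])
      have := Real.continuous_fourierChar
      fun_prop
    refine h2.congr (Filter.Eventually.of_forall fun z => ?_)
    simp only [Function.uncurry]
    ring
  calc 𝓕 (fun ζ => f ζ * b (⟪v₀, ζ⟫ + c₀)) p
      = ∫ ζ : V, ∫ s : ℝ, (Real.fourierChar (-⟪ζ, p⟫) : ℂ) *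
          (f ζ * ((Real.fourierChar (s * (⟪v₀, ζ⟫ + c₀)) : ℂ) * 𝓕 b s)) := by
        rw [Real.fourier_eq]
        refine integral_congr_ae (Filter.Eventually.of_forall fun ζ => ?_)
        simp only [Circle.smul_def, smul_eq_mul]
        rw [hb, integral_const_mul, integral_const_mul]
    _ = ∫ s : ℝ, ∫ ζ : V, (Real.fourierChar (-⟪ζ, p⟫) : ℂ) *
          (f ζ * ((Real.fourierChar (s * (⟪v₀, ζ⟫ + c₀)) : ℂ) * 𝓕 b s)) :=
        integral_integral_swap hint
    _ = _ := by
        refine integral_congr_ae (Filter.Eventually.of_forall fun s => ?_)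
        simp only [Real.fourier_eq f]
        rw [← integral_const_mul]
        refine integral_congr_ae (Filter.Eventually.of_forall fun ζ => ?_)
        simp only [Circle.smul_def, smul_eq_mul]
        have : (Real.fourierChar (-⟪ζ, p - s • v₀⟫) : ℂ) =
            Real.fourierChar (-⟪ζ, p⟫) * Real.fourierChar (s * ⟪v₀, ζ⟫) := by
          rw [← Circle.coe_mul, ← AddChar.map_add_eq_mul, inner_sub_right, inner_smul_right,
            real_inner_comm v₀ ζ]
          congr 2; ring
        rw [this, mul_add, AddChar.map_add_eq_mul, Circle.coe_mul]
        ring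

theorem fourierInv_mul_comp_affine {f : V → ℂ} (hf : Integrable f) (b : 𝓢(ℝ, ℂ)) (v₀ : V)
    (c₀ : ℝ) (p : V) :
    𝓕⁻ (fun ζ => f ζ * b (⟪v₀, ζ⟫ + c₀)) p =
      ∫ s : ℝ, 𝓕 b s * (Real.fourierChar (s * c₀) : ℂ) * 𝓕⁻ f (p + s • v₀) := by
  simp only [Real.fourierInv_eq_fourier_neg, fourier_mul_comp_affine hf, neg_add']

theorem fourier_comp_add_right (f : V → ℂ) (v w : V) :
    𝓕 (fun p => f (p + v)) w = Real.fourierChar ⟪v, w⟫ * 𝓕 f w := by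
  have := congrFun (VectorFourier.fourierIntegral_comp_add_right Real.fourierChar volume
    (innerₗ V) f v) w
  exact this

theorem fourierInv_fourierChar_mul (f : V → ℂ) (v p : V) :
    𝓕⁻ (fun w => (Real.fourierChar ⟪v, w⟫ : ℂ) * f w) p = 𝓕⁻ f (p + v) := by
  simp only [Real.fourierInv_eq]
  refine integral_congr_ae (Filter.Eventually.of_forall fun w => ?_)
  simp only [Circle.smul_def, smul_eq_mul]
  rw [inner_add_right, AddChar.map_add_eq_mul, Circle.coe_mul, real_inner_comm w v]
  ring

end Fourier

/-! ### Projections and time weights as operators on Schwartz functions -/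

variable {d : ℕ}

theorem inner_pt (x : Space d) (t : ℝ) (p : SpaceTime d) :
    ⟪pt x t, p⟫ = ⟪x, p.fst⟫ + t * p.snd := by
  simp [pt, WithLp.prod_inner_apply, mul_comm]

/-- The map is affine: a continuous linear map plus its value at 0. Hence `χ ∘ A_ω` is a legitimate
multiplier on Schwartz space. -/
theorem hasTemperateGrowth_rescale (δ : ℝ) (ω : Space d) :
    (rescale (d := d) δ ω).HasTemperateGrowth := by
  let Φ : SpaceTime d →L[ℝ] SpaceTime d :=
    ((WithLp.prodContinuousLinearEquiv 2 ℝ (Space d) ℝ).symm : _ →L[ℝ] SpaceTime d) ∘L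
      ((δ⁻¹ • WithLp.fstL 2 ℝ (Space d) ℝ).prod ((2 * d * δ ^ 2)⁻¹ •
        (WithLp.sndL 2 ℝ (Space d) ℝ - (2 : ℝ) • (innerSL ℝ ω ∘L WithLp.fstL 2 ℝ (Space d) ℝ))))
  have : rescale (d := d) δ ω = fun p => Φ p + rescale δ ω 0 := by
    funext p
    refine (WithLp.ofLp_injective 2) (Prod.ext ?_ ?_)
    · simp [Φ, rescale, pt, sub_eq_add_neg]
    · simp [Φ, rescale, pt, inner_sub_right]
      ring
  rw [this]
  fun_prop

/-- The smoothed Fourier projection as an operator on Schwartz functions. -/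
def schwartzProj (χ : 𝓢(SpaceTime d, ℂ)) (δ : ℝ) (ω : Space d) (g : 𝓢(SpaceTime d, ℂ)) :
    𝓢(SpaceTime d, ℂ) :=
  𝓕⁻ (SchwartzMap.smulLeftCLM ℂ (fun p => χ (rescale δ ω p)) (𝓕 g))

theorem hasTemperateGrowth_comp_rescale (χ : 𝓢(SpaceTime d, ℂ)) (δ : ℝ) (ω : Space d) :
    (fun p => χ (rescale δ ω p)).HasTemperateGrowth :=
  χ.hasTemperateGrowth.comp (hasTemperateGrowth_rescale δ ω)

theorem fourier_schwartzProj (χ : 𝓢(SpaceTime d, ℂ)) (δ : ℝ) (ω : Space d)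
    (g : 𝓢(SpaceTime d, ℂ)) (p : SpaceTime d) :
    𝓕 (schwartzProj χ δ ω g) p = 𝓕 g p * χ (rescale δ ω p) := by
  rw [schwartzProj, FourierTransform.fourier_fourierInv_eq,
    SchwartzMap.smulLeftCLM_apply_apply (hasTemperateGrowth_comp_rescale χ δ ω), smul_eq_mul,
    mul_comm]

theorem coe_schwartzProj (χ : 𝓢(SpaceTime d, ℂ)) (δ : ℝ) (ω : Space d)
    (g : 𝓢(SpaceTime d, ℂ)) : ⇑(schwartzProj χ δ ω g) = smoothProj χ δ ω g := by
  rw [schwartzProj, SchwartzMap.fourierInv_coe, smoothProj]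
  congr 1
  funext p
  rw [SchwartzMap.smulLeftCLM_apply_apply (hasTemperateGrowth_comp_rescale χ δ ω), smul_eq_mul,
    mul_comm, SchwartzMap.fourier_coe]

theorem rescale_mem_cube_iff (hd : 1 ≤ d) {δ : ℝ} (hδ : 0 < δ) {κ : ℝ} (ω : Space d)
    (p : SpaceTime d) : rescale δ ω p ∈ cube d κ ↔ p ∈ plank κ δ ω := by
  have hd' : (0 : ℝ) < d := by exact_mod_cast hd
  have h2 : 0 < 2 * (d : ℝ) * δ ^ 2 := by positivity
  simp only [cube, plank, rescale, pt, Set.mem_ofPred_eq, WithLp.toLp_fst, WithLp.toLp_snd,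
    PiLp.smul_apply, PiLp.sub_apply, smul_eq_mul, abs_div, abs_mul, abs_inv, abs_of_pos hδ,
    abs_of_pos h2]
  simp only [div_le_iff₀ h2, inv_mul_le_iff₀ hδ, mul_comm δ κ]

theorem fourier_schwartzProj_eq_zero (hd : 1 ≤ d) {χ : 𝓢(SpaceTime d, ℂ)} (hχ : IsCutoff χ)
    {δ : ℝ} (hδ : 0 < δ) (ω : Space d) (g : 𝓢(SpaceTime d, ℂ)) {p : SpaceTime d}
    (hp : p ∉ plank 2 δ ω) : 𝓕 (schwartzProj χ δ ω g) p = 0 := by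
  rw [fourier_schwartzProj, hχ.2 _ (mt (rescale_mem_cube_iff hd hδ ω p).1 hp), mul_zero]

/-- Multiplication by the time weight adapted to `[0, δ⁻²]`, on Schwartz functions. -/
def weightMul (φ : 𝓢(ℝ, ℝ)) (δ : ℝ) (f : 𝓢(SpaceTime d, ℂ)) : 𝓢(SpaceTime d, ℂ) :=
  SchwartzMap.smulLeftCLM ℂ (fun p => (adapted φ 0 (δ ^ 2)⁻¹ p.snd : ℂ)) f

theorem adapted_eq (φ : 𝓢(ℝ, ℝ)) (δ t : ℝ) (hδ : 0 < δ) :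
    adapted φ 0 (δ ^ 2)⁻¹ t = φ (δ ^ 2 * t - 1 / 2) := by
  rw [adapted]
  congr 1
  field_simp
  ring

theorem weightMul_apply (φ : 𝓢(ℝ, ℝ)) (δ : ℝ) (f : 𝓢(SpaceTime d, ℂ)) (p : SpaceTime d) :
    weightMul φ δ f p = f p * (adapted φ 0 (δ ^ 2)⁻¹ p.snd : ℂ) := by
  have h1 : (fun p : SpaceTime d => p.snd).HasTemperateGrowth :=
    (WithLp.sndL 2 ℝ (Space d) ℝ).hasTemperateGrowth
  have h2 : (fun p : SpaceTime d =>
      (p.snd - (0 + (δ ^ 2)⁻¹) / 2) / ((δ ^ 2)⁻¹ - 0)).HasTemperateGrowth := by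
    simp only [div_eq_mul_inv]
    fun_prop
  have h3 : (fun p : SpaceTime d => (adapted φ 0 (δ ^ 2)⁻¹ p.snd : ℂ)).HasTemperateGrowth :=
    Function.Complex.hasTemperateGrowth_ofReal.comp (φ.hasTemperateGrowth.comp h2)
  rw [weightMul, SchwartzMap.smulLeftCLM_apply_apply h3, smul_eq_mul, mul_comm]

/-- Multiplication by the time weight enlarges the Fourier support by `δ²` in the time
frequency. -/
theorem fourier_weightMul_eq_zero {φ : 𝓢(ℝ, ℝ)} (hφ : IsTimeWeight φ) {δ : ℝ} (hδ : 0 < δ)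
    (f : 𝓢(SpaceTime d, ℂ)) {p : SpaceTime d}
    (hp : ∀ s : ℝ, |s| ≤ δ ^ 2 → 𝓕 f (p - pt 0 s) = 0) :
    𝓕 (weightMul φ δ f) p = 0 := by
  let φc : 𝓢(ℝ, ℂ) := φ.postcompCLM Complex.ofRealCLM
  have hφc : ∀ t, φc t = (φ t : ℂ) := fun t => rfl
  -- The weight is `φ` of the affine functional `δ² t - 1/2`, so its frequencies `|s| ≤ 1` become
  -- shifts by `s δ²` in the time frequency.
  have hfun : ⇑(weightMul φ δ f) =
      fun ζ => f ζ * φc (⟪(pt 0 (δ ^ 2) : SpaceTime d), ζ⟫ + (-(1 / 2))) := by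
    funext ζ
    rw [weightMul_apply, hφc, adapted_eq φ δ _ hδ, inner_pt]
    simp [sub_eq_add_neg]
  rw [SchwartzMap.fourier_coe, hfun, fourier_mul_comp_affine f.integrable]
  refine integral_eq_zero_of_ae (Filter.Eventually.of_forall fun s => ?_)
  by_cases hs : |s| ≤ 1
  · have h1 := hp (s * δ ^ 2) (by
      rw [abs_mul, abs_of_nonneg (sq_nonneg δ)]
      exact mul_le_of_le_one_left (sq_nonneg δ) hs)
    have h2 : s • (pt 0 (δ ^ 2) : SpaceTime d) = pt 0 (s * δ ^ 2) := by
      refine (WithLp.ofLp_injective 2) (Prod.ext ?_ ?_) <;> simp [pt]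
    simp only [h2, Pi.zero_apply]
    rw [← SchwartzMap.fourier_coe, h1, mul_zero]
  · have : 𝓕 φc s = 0 := by
      by_contra hne
      exact hs (abs_le.2 (hφ.2.2 (show s ∈ Function.support (𝓕 fun t : ℝ => (φ t : ℂ)) from hne)))
    simp [this]

/-! ### Bernstein's inequality in time -/

/-- A function whose Fourier transform lives in a slab parallel to the tangent plane of the
paraboloid at `ω` is an average of its translates along the corresponding direction. -/
theorem norm_le_integral_translates {M : ℝ} (b : 𝓢(ℝ, ℂ)) (hb : ∀ y, |y| ≤ M → b y = 1)
    {δ : ℝ} (hδ : 0 < δ) (ω : Space d) (u : 𝓢(SpaceTime d, ℂ))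
    (hu : ∀ p : SpaceTime d, M * δ ^ 2 < |p.snd - 2 * ⟪ω, p.fst - ω⟫ - ‖ω‖ ^ 2| → 𝓕 u p = 0)
    (x : Space d) (t : ℝ) :
    ‖u (pt x t)‖ₑ ≤
      ∫⁻ s : ℝ, ‖𝓕 b s‖ₑ *
        ‖u (pt (x - (s * (2 * (δ ^ 2)⁻¹)) • ω) (t + s * (δ ^ 2)⁻¹))‖ₑ := by
  have hδ2 : 0 < δ ^ 2 := by positivity
  -- With this vector, `⟪v₀, ζ⟫ + ‖ω‖² δ⁻²` is the slab coordinate divided by `δ²`; inserting `b` of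
  -- it changes nothing on the spectrum of `u`.
  set v₀ : SpaceTime d := pt (-((2 * (δ ^ 2)⁻¹) • ω)) (δ ^ 2)⁻¹ with hv₀
  have hfun : ⇑(𝓕 u : 𝓢(SpaceTime d, ℂ)) = fun ζ => (𝓕 u : 𝓢(SpaceTime d, ℂ)) ζ * b (⟪v₀, ζ⟫ + ‖ω‖ ^ 2 * (δ ^ 2)⁻¹) := by
    funext ζ
    have harg : ⟪v₀, ζ⟫ + ‖ω‖ ^ 2 * (δ ^ 2)⁻¹ =
        (ζ.snd - 2 * ⟪ω, ζ.fst - ω⟫ - ‖ω‖ ^ 2) / δ ^ 2 := by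
      rw [hv₀, inner_pt, inner_neg_left, inner_smul_left, inner_sub_right,
        real_inner_self_eq_norm_sq]
      simp only [map_mul, conj_trivial]
      field_simp
      ring
    by_cases hζ : M * δ ^ 2 < |ζ.snd - 2 * ⟪ω, ζ.fst - ω⟫ - ‖ω‖ ^ 2|
    · rw [hu ζ hζ, zero_mul]
    · rw [harg, hb _ (by rw [abs_div, abs_of_pos hδ2, div_le_iff₀ hδ2]; exact not_lt.1 hζ), mul_one]
  have hinv : ∀ p, u p = 𝓕⁻ (⇑(𝓕 u : 𝓢(SpaceTime d, ℂ))) p := fun p => by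
    rw [← SchwartzMap.fourierInv_coe, FourierTransform.fourierInv_fourier_eq (F := 𝓢(SpaceTime d, ℂ))]
  have hrep : u (pt x t) = ∫ s : ℝ, 𝓕 b s *
      (Real.fourierChar (s * (‖ω‖ ^ 2 * (δ ^ 2)⁻¹)) : ℂ) * u (pt x t + s • v₀) := by
    rw [hinv, hfun, fourierInv_mul_comp_affine (𝓕 u : 𝓢(SpaceTime d, ℂ)).integrable]
    simp only [← hinv]
  rw [hrep]
  refine (enorm_integral_le_lintegral_enorm _).trans (lintegral_mono fun s => le_of_eq ?_)
  have h3 : pt x t + s • v₀ = pt (x - (s * (2 * (δ ^ 2)⁻¹)) • ω) (t + s * (δ ^ 2)⁻¹) := by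
    refine (WithLp.ofLp_injective 2) (Prod.ext ?_ ?_)
    · simp [pt, hv₀, smul_smul, sub_eq_add_neg]
    · simp [pt, hv₀]
  rw [h3, enorm_mul, enorm_mul]
  have : ‖(Real.fourierChar (s * (‖ω‖ ^ 2 * (δ ^ 2)⁻¹)) : ℂ)‖ₑ = 1 := by
    rw [← ofReal_norm, Circle.norm_coe]; simp
  rw [this, mul_one]

section Bernstein

theorem eLpNorm_comp_add_mul (N : ℝ → ℝ≥0∞) (hN : Measurable N) {p : ℝ≥0∞} (hp : p ≠ ∞)
    {L : ℝ} (hL : 0 < L) (t : ℝ) :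
    eLpNorm (fun s => N (t + s * L)) p volume =
      ENNReal.ofReal L⁻¹ ^ (1 / p.toReal) * eLpNorm N p volume := by
  have h1 : eLpNorm (fun s => N (t + s * L)) p volume =
      eLpNorm (fun y => N (t + y)) p (Measure.map (· * L) volume) :=
    (eLpNorm_map_measure (g := fun y => N (t + y)) (f := fun s => s * L)
      (hN.comp (measurable_const_add t)).aestronglyMeasurable
      (measurable_mul_const L).aemeasurable).symm
  have h2 : eLpNorm (fun y => N (t + y)) p volume = eLpNorm N p volume :=
    eLpNorm_comp_measurePreserving hN.aestronglyMeasurable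
      (measurePreserving_add_left volume t)
  rw [h1, Real.map_volume_mul_right hL.ne', eLpNorm_smul_measure_of_ne_top hp, h2,
    abs_of_pos (inv_pos.2 hL), smul_eq_mul, ENNReal.toReal_div, ENNReal.toReal_one]

/-- A function dominated by its own average at scale `L` obeys Bernstein's inequality. -/
theorem eLpNorm_le_of_le_average {κ : ℝ → ℝ≥0∞} (hκ : Measurable κ) {K : ℝ≥0∞}
    (hK : ∀ s, κ s ≤ K) {p q : ℝ≥0∞} (hp1 : 1 ≤ p) (hpq : p < q)
    {N : ℝ → ℝ≥0∞} (hN : Measurable N) {L : ℝ} (hL : 0 < L)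
    (h : ∀ t, N t ≤ ∫⁻ s, κ s * N (t + s * L)) :
    eLpNorm N q volume ≤
      (K ^ (1 / p.toReal) * (∫⁻ s, κ s) ^ (1 - 1 / p.toReal)) ^ (1 - p.toReal / q.toReal) *
        (ENNReal.ofReal L⁻¹ ^ (1 / p.toReal - 1 / q.toReal) * eLpNorm N p volume) := by
  have hp : p ≠ ∞ := (hpq.trans_le le_top).ne
  have hp0 : p ≠ 0 := (zero_lt_one.trans_le hp1).ne'
  have hpr : 1 ≤ p.toReal := by simpa using ENNReal.toReal_mono hp hp1
  set a := p.toReal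
  set E := eLpNorm N p volume with hE
  set lam := ENNReal.ofReal L⁻¹ with hlam
  set C₀ := K ^ (1 / a) * (∫⁻ s, κ s) ^ (1 - 1 / a) with hC₀
  -- The endpoint `q = ∞`: Hölder for the finite measure `κ ds`, which is also at most `K` times
  -- Lebesgue measure.
  have hsup : ∀ t, N t ≤ C₀ * (lam ^ (1 / a) * E) := fun t => by
    set Nt : ℝ → ℝ≥0∞ := fun s => N (t + s * L) with hNt
    have hNtm : Measurable Nt := hN.comp (by fun_prop)
    set ν : Measure ℝ := volume.withDensity κ with hν
    have hνK : ν ≤ K • volume := by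
      rw [hν, ← withDensity_const]
      exact withDensity_mono (Filter.Eventually.of_forall hK)
    calc N t ≤ ∫⁻ s, κ s * Nt s := h t
      _ = eLpNorm Nt 1 ν := by
        rw [eLpNorm_one_eq_lintegral_enorm, hν,
          lintegral_withDensity_eq_lintegral_mul _ hκ (by simpa using hNtm)]
        simp
      _ ≤ eLpNorm Nt p ν * ν Set.univ ^ (1 / (1 : ℝ≥0∞).toReal - 1 / p.toReal) :=
        eLpNorm_le_eLpNorm_mul_rpow_measure_univ hp1 hNtm.aestronglyMeasurable
      _ ≤ (K ^ (1 / a) * (lam ^ (1 / a) * E)) * (∫⁻ s, κ s) ^ (1 - 1 / a) := by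
        refine mul_le_mul' ?_ (le_of_eq ?_)
        · refine (eLpNorm_le_of_measure_le_smul hνK).trans (le_of_eq ?_)
          rw [hNt, eLpNorm_comp_add_mul N hN hp hL, smul_eq_mul, ENNReal.toReal_div,
            ENNReal.toReal_one]
        · rw [hν, withDensity_apply _ MeasurableSet.univ, Measure.restrict_univ]
          simp [a]
      _ = C₀ * (lam ^ (1 / a) * E) := by rw [hC₀]; ring
  clear_value C₀
  rcases eq_or_ne q ∞ with rfl | hq
  · simp only [ENNReal.toReal_top, div_zero, sub_zero, ENNReal.rpow_one, eLpNorm_exponent_top]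
    refine essSup_le_of_ae_le _ (Filter.Eventually.of_forall fun t => ?_)
    simpa using hsup t
  have hq0 : q ≠ 0 := (hpq.trans_le' bot_le).ne'
  have hab : a < q.toReal := (ENNReal.toReal_lt_toReal hp hq).2 hpq
  set b := q.toReal
  have hb : 0 < b := by linarith
  have ha : 0 < a := by linarith
  set B := C₀ * (lam ^ (1 / a) * E) with hB
  have hEa : ∫⁻ t, N t ^ a = E ^ a := by
    rw [hE, eLpNorm_eq_lintegral_rpow_enorm_toReal hp0 hp, ← ENNReal.rpow_mul]
    simp [a, ha.ne']
  rw [eLpNorm_eq_lintegral_rpow_enorm_toReal hq0 hq]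
  -- Finite `q` follows by interpolating between the sup bound and `L^p`.
  have h1 : ∫⁻ t, N t ^ b ≤ B ^ (b - a) * E ^ a := by
    rw [← hEa, ← lintegral_const_mul _ (hN.pow_const a)]
    refine lintegral_mono fun t => ?_
    calc N t ^ b = N t ^ ((b - a) + a) := by ring_nf
      _ = N t ^ (b - a) * N t ^ a := ENNReal.rpow_add_of_nonneg _ _ (by linarith) (by linarith)
      _ ≤ _ := mul_le_mul' (ENNReal.rpow_le_rpow (hsup t) (by linarith)) le_rfl
  have hb' : (0 : ℝ) ≤ 1 / b := by positivity
  have hab' : 0 ≤ 1 - a / b := by rw [sub_nonneg, div_le_one hb]; exact hab.le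
  calc (∫⁻ t, ‖N t‖ₑ ^ b) ^ (1 / b) ≤ (B ^ (b - a) * E ^ a) ^ (1 / b) := by
        simpa using ENNReal.rpow_le_rpow h1 hb'
    _ = B ^ (1 - a / b) * E ^ (a / b) := by
        rw [ENNReal.mul_rpow_of_nonneg _ _ hb', ← ENNReal.rpow_mul, ← ENNReal.rpow_mul]
        congr 2 <;> field_simp
    _ = C₀ ^ (1 - a / b) * (lam ^ (1 / a - 1 / b) * (E ^ (1 - a / b) * E ^ (a / b))) := by
        rw [hB, ENNReal.mul_rpow_of_nonneg _ _ hab', ENNReal.mul_rpow_of_nonneg _ _ hab',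
          ← ENNReal.rpow_mul, show 1 / a * (1 - a / b) = 1 / a - 1 / b by field_simp]
        ring
    _ = _ := by
        rw [← ENNReal.rpow_add_of_nonneg _ _ hab' (by positivity), sub_add_cancel,
          ENNReal.rpow_one]

/-- Minkowski applied to the average of translates. The tilt along `ω` is a translation in `x`,
invisible to the `L^r_x` norm, so a purely one-dimensional inequality in time remains. -/
theorem sliceNorm_le_average {M : ℝ} (b : 𝓢(ℝ, ℂ)) (hb : ∀ y, |y| ≤ M → b y = 1)
    {δ : ℝ} (hδ : 0 < δ) (ω : Space d) (u : 𝓢(SpaceTime d, ℂ))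
    (hu : ∀ p : SpaceTime d, M * δ ^ 2 < |p.snd - 2 * ⟪ω, p.fst - ω⟫ - ‖ω‖ ^ 2| → 𝓕 u p = 0)
    {r : ℝ≥0∞} (hr : 1 ≤ r) (t : ℝ) :
    sliceNorm r u t ≤ ∫⁻ s : ℝ, ‖𝓕 b s‖ₑ * sliceNorm r u (t + s * (δ ^ 2)⁻¹) := by
  set f : Space d → ℝ → ℝ≥0∞ := fun x s => ‖𝓕 b s‖ₑ *
    ‖u (pt (x - (s * (2 * (δ ^ 2)⁻¹)) • ω) (t + s * (δ ^ 2)⁻¹))‖ₑ with hf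
  have hslice : ∀ s, eLpNorm (fun x => f x s) r volume =
      ‖𝓕 b s‖ₑ * sliceNorm r u (t + s * (δ ^ 2)⁻¹) := fun s => by
    have h1 : eLpNorm (fun x => f x s) r volume = eLpNorm (𝓕 b s • fun x =>
        u (pt (x - (s * (2 * (δ ^ 2)⁻¹)) • ω) (t + s * (δ ^ 2)⁻¹))) r volume := by
      conv_rhs => rw [← eLpNorm_enorm]
      simp [hf, enorm_mul]
    rw [h1, eLpNorm_const_smul]
    congr 1
    exact eLpNorm_comp_measurePreserving
      (continuous_slice u.continuous (t + s * (δ ^ 2)⁻¹)).aestronglyMeasurable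
      (measurePreserving_sub_right volume ((s * (2 * (δ ^ 2)⁻¹)) • ω))
  have hfm : Measurable (Function.uncurry f) := by
    have h1 : Continuous fun z : Space d × ℝ =>
        u (pt (z.1 - (z.2 * (2 * (δ ^ 2)⁻¹)) • ω) (t + z.2 * (δ ^ 2)⁻¹)) :=
      u.continuous.comp (continuous_pt.comp (by fun_prop : Continuous fun z : Space d × ℝ =>
        (z.1 - (z.2 * (2 * (δ ^ 2)⁻¹)) • ω, t + z.2 * (δ ^ 2)⁻¹)))
    have h2 : Continuous fun z : Space d × ℝ => 𝓕 b z.2 :=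
      (SchwartzMap.continuous (𝓕 b)).comp continuous_snd
    exact h2.enorm.measurable.mul h1.enorm.measurable
  have hbm : Measurable fun s : ℝ => ‖𝓕 b s‖ₑ := (SchwartzMap.continuous (𝓕 b)).enorm.measurable
  calc sliceNorm r u t ≤ eLpNorm (fun x => ∫⁻ s, f x s) r volume :=
        eLpNorm_mono_enorm fun x => by
          simpa [hf] using norm_le_integral_translates b hb hδ ω u hu x t
    _ ≤ ∫⁻ s, eLpNorm (fun x => f x s) r volume := by
        refine eLpNorm_lintegral_le hfm hr ?_
        simp only [hslice]
        exact hbm.mul ((measurable_sliceNorm r u.continuous).comp (by fun_prop))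
    _ = _ := by simp only [hslice]

theorem exists_schwartz_eq_one (M : ℝ) (hM : 0 < M) :
    ∃ b : 𝓢(ℝ, ℂ), ∀ y, |y| ≤ M → b y = 1 := by
  let B : ContDiffBump (0 : ℝ) := ⟨M, M + 1, hM, by linarith⟩
  refine ⟨(B.hasCompactSupport.toSchwartzMap B.contDiff).postcompCLM Complex.ofRealCLM,
    fun y hy => ?_⟩
  have : B y = 1 := B.one_of_mem_closedBall (by simpa [B] using hy)
  simp [this]

/-- Bernstein's inequality in time for the pieces `f_ω` multiplied by the time weight. -/
theorem exists_bernstein_const (d : ℕ) {p q : ℝ≥0∞} (hp : 1 ≤ p) (hpq : p < q) :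
    ∃ C : ℝ≥0, ∀ (r : ℝ≥0∞), 1 ≤ r → ∀ (δ : ℝ), 0 < δ → ∀ (ω : Space d) (u : 𝓢(SpaceTime d, ℂ)),
      (∀ z : SpaceTime d,
        (4 * d + 1) * δ ^ 2 < |z.snd - 2 * ⟪ω, z.fst - ω⟫ - ‖ω‖ ^ 2| → 𝓕 u z = 0) →
      mixedNorm q r Set.univ u ≤ C * (ENNReal.ofReal (δ ^ 2) ^ (1 / p.toReal - 1 / q.toReal) *
        mixedNorm p r Set.univ u) := by
  -- The width `4d + 1` is the half-thickness `4d` of `2θ_ω` in units of `δ²`, plus 1 for the blur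
  -- caused by the time weight.
  obtain ⟨b, hb⟩ := exists_schwartz_eq_one (4 * d + 1) (by positivity)
  have hpr : 1 ≤ p.toReal := by simpa using ENNReal.toReal_mono (hpq.trans_le le_top).ne hp
  obtain ⟨K, hK⟩ : ∃ K : ℝ≥0, ∀ s, ‖𝓕 b s‖ₑ ≤ K := by
    refine ⟨(SchwartzMap.seminorm ℝ 0 0 (𝓕 b)).toNNReal, fun s => ?_⟩
    rw [← ofReal_norm]
    exact ENNReal.ofReal_le_ofReal (SchwartzMap.norm_le_seminorm ℝ (𝓕 b) s)
  have hint : ∫⁻ s, ‖𝓕 b s‖ₑ ≠ ∞ := (𝓕 b).integrable.hasFiniteIntegral.ne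
  have hexp : 0 ≤ 1 - 1 / p.toReal := by
    rw [sub_nonneg, div_le_one (by linarith)]; exact hpr
  have hexp2 : 0 ≤ 1 - p.toReal / q.toReal := by
    rw [sub_nonneg]
    rcases eq_or_ne q ∞ with rfl | hq
    · simp
    · have := (ENNReal.toReal_lt_toReal (hpq.trans_le le_top).ne hq).2 hpq
      exact (div_le_one (by linarith)).2 this.le
  have hfin : ((K : ℝ≥0∞) ^ (1 / p.toReal) * (∫⁻ s, ‖𝓕 b s‖ₑ) ^ (1 - 1 / p.toReal)) ^
      (1 - p.toReal / q.toReal) ≠ ∞ := by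
    refine ENNReal.rpow_ne_top_of_nonneg hexp2 (ENNReal.mul_ne_top ?_ ?_)
    · exact ENNReal.rpow_ne_top_of_nonneg (by positivity) ENNReal.coe_ne_top
    · exact ENNReal.rpow_ne_top_of_nonneg hexp hint
  obtain ⟨C, hC⟩ := WithTop.ne_top_iff_exists.1 hfin
  refine ⟨C, fun r hr δ hδ ω u hu => ?_⟩
  have := eLpNorm_le_of_le_average (SchwartzMap.continuous (𝓕 b)).enorm.measurable hK hp hpq
    (measurable_sliceNorm r u.continuous) (L := (δ ^ 2)⁻¹) (by positivity)
    (fun t => sliceNorm_le_average b hb hδ ω u hu hr t)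
  rw [inv_inv, ← hC] at this
  simp only [mixedNorm, Measure.restrict_univ]
  exact this

end Bernstein

/-! ### Working with the best constants -/

section Constants

/-- The `ℓ²` combination of the norms of the pieces. -/
def ell2 {ι : Type*} (s : Finset ι) (a : ι → ℝ≥0∞) : ℝ≥0∞ := (∑ i ∈ s, a i ^ 2) ^ (1 / 2 : ℝ)

theorem ell2_le_mul {ι : Type*} {s : Finset ι} {a b : ι → ℝ≥0∞} {c : ℝ≥0∞}
    (h : ∀ i ∈ s, a i ≤ c * b i) : ell2 s a ≤ c * ell2 s b := by
  calc ell2 s a ≤ (c ^ 2 * ∑ i ∈ s, b i ^ 2) ^ (1 / 2 : ℝ) := by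
        refine ENNReal.rpow_le_rpow ?_ (by norm_num)
        rw [Finset.mul_sum]
        refine Finset.sum_le_sum fun i hi => ?_
        rw [← mul_pow]
        exact pow_le_pow_left' (h i hi) 2
    _ = c * ell2 s b := by
        rw [ENNReal.mul_rpow_of_nonneg _ _ (by norm_num), ← ENNReal.rpow_natCast,
          ← ENNReal.rpow_mul, ell2]
        norm_num

theorem ell2_mono {ι : Type*} {s t : Finset ι} {a : ι → ℝ≥0∞} (h : s ⊆ t) :
    ell2 s a ≤ ell2 t a :=
  ENNReal.rpow_le_rpow (Finset.sum_le_sum_of_subset h) (by norm_num)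

theorem ell2_congr {ι : Type*} {s : Finset ι} {a b : ι → ℝ≥0∞} (h : ∀ i ∈ s, a i = b i) :
    ell2 s a = ell2 s b := by
  rw [ell2, ell2, Finset.sum_congr rfl fun i hi => by rw [h i hi]]

/-- The decoupling constants are suprema of infima and may be infinite, so inequalities are tested
on finite `D` strictly above them. A nonzero `c` is needed when `a = ∞`, where the hypothesis is
vacuous; this is why later constants are taken as `C + 1`. -/
theorem le_mul_of_forall_gt {a b : ℝ≥0∞} {c : ℝ≥0} (hc : c ≠ 0)
    (h : ∀ D : ℝ≥0, a < D → b ≤ c * D) : b ≤ c * a := by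
  have hc' : (c : ℝ≥0∞) ≠ 0 := by simpa using hc
  rw [← ENNReal.div_le_iff' hc' ENNReal.coe_ne_top]
  refine le_of_forall_gt_imp_ge_of_dense fun D hD => ?_
  rcases eq_or_ne D ∞ with rfl | hD'
  · exact le_top
  lift D to ℝ≥0 using hD'
  rw [ENNReal.div_le_iff' hc' ENNReal.coe_ne_top]
  exact h D hD

theorem global_decoupling_of_lt {χ : 𝓢(SpaceTime d, ℂ)} {q r : ℝ≥0∞} {δ : ℝ} {D : ℝ≥0∞}
    (hD : globalConst χ q r δ < D) {Ξ : Finset (Space d)} (hΞ : IsAdmissible δ Ξ)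
    (g : 𝓢(SpaceTime d, ℂ)) (hg : HasFourierSupport δ Ξ g) :
    mixedNorm q r Set.univ (fun p => ∑ ω ∈ Ξ, smoothProj χ δ ω g p) ≤
      D * ell2 Ξ fun ω => mixedNorm q r Set.univ (smoothProj χ δ ω g) := by
  obtain ⟨C, hC, hCD⟩ := sInf_lt_iff.1 ((le_iSup₂ (f := fun Ξ (_ : IsAdmissible δ Ξ) =>
    globalConstOn χ q r δ Ξ) Ξ hΞ).trans_lt hD)
  exact (hC g hg).trans (mul_le_mul' hCD.le le_rfl)

theorem local_decoupling_of_lt {χ : 𝓢(SpaceTime d, ℂ)} {φ : 𝓢(ℝ, ℝ)} {q r : ℝ≥0∞} {δ : ℝ}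
    {D : ℝ≥0∞} (hD : localConst χ φ q r δ < D) {Ξ : Finset (Space d)} (hΞ : IsAdmissible δ Ξ)
    (g : 𝓢(SpaceTime d, ℂ)) (hg : HasFourierSupport δ Ξ g) :
    mixedNorm q r (Set.Icc 0 (δ ^ 2)⁻¹) (fun p => ∑ ω ∈ Ξ, smoothProj χ δ ω g p) ≤
      D * ell2 Ξ fun ω => mixedNorm q r Set.univ (weightMul φ δ (schwartzProj χ δ ω g)) := by
  obtain ⟨C, hC, hCD⟩ := sInf_lt_iff.1 ((le_iSup₂ (f := fun Ξ (_ : IsAdmissible δ Ξ) =>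
    localConstOn χ φ q r δ Ξ) Ξ hΞ).trans_lt hD)
  refine (hC g hg).trans (mul_le_mul' hCD.le (le_of_eq ?_))
  refine ell2_congr fun ω _ => ?_
  rw [weightedMixedNorm]
  congr 1
  funext p
  rw [weightMul_apply, coe_schwartzProj]

theorem globalConst_le {χ : 𝓢(SpaceTime d, ℂ)} {q r : ℝ≥0∞} {δ : ℝ} {D : ℝ≥0∞}
    (h : ∀ Ξ : Finset (Space d), IsAdmissible δ Ξ → ∀ g : 𝓢(SpaceTime d, ℂ),
      HasFourierSupport δ Ξ g →
      mixedNorm q r Set.univ (fun p => ∑ ω ∈ Ξ, smoothProj χ δ ω g p) ≤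
        D * ell2 Ξ fun ω => mixedNorm q r Set.univ (smoothProj χ δ ω g)) :
    globalConst χ q r δ ≤ D :=
  iSup₂_le fun Ξ hΞ => sInf_le fun g hg => h Ξ hΞ g hg

theorem localConst_le {χ : 𝓢(SpaceTime d, ℂ)} {φ : 𝓢(ℝ, ℝ)} {q r : ℝ≥0∞} {δ : ℝ} {D : ℝ≥0∞}
    (h : ∀ Ξ : Finset (Space d), IsAdmissible δ Ξ → ∀ g : 𝓢(SpaceTime d, ℂ),
      HasFourierSupport δ Ξ g →
      mixedNorm q r (Set.Icc 0 (δ ^ 2)⁻¹) (fun p => ∑ ω ∈ Ξ, smoothProj χ δ ω g p) ≤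
        D * ell2 Ξ fun ω => mixedNorm q r Set.univ (weightMul φ δ (schwartzProj χ δ ω g))) :
    localConst χ φ q r δ ≤ D := by
  refine iSup₂_le fun Ξ hΞ => sInf_le fun g hg => (h Ξ hΞ g hg).trans (le_of_eq ?_)
  congr 1
  refine ell2_congr fun ω _ => ?_
  rw [weightedMixedNorm]
  congr 1
  funext p
  rw [weightMul_apply, coe_schwartzProj]

end Constants

/-! ### Lowering the time exponent of the local constant -/

/-- The piece has spectrum in `2θ_ω`, and the weight shifts only the time frequency, by at most
`δ²`: the spatial box is unchanged and the half-thickness grows from `4dδ²` to `(4d + 1)δ²`. -/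
theorem mem_slab_of_fourier_weightMul_ne_zero (hd : 1 ≤ d) {χ : 𝓢(SpaceTime d, ℂ)}
    (hχ : IsCutoff χ) {φ : 𝓢(ℝ, ℝ)} (hφ : IsTimeWeight φ) {δ : ℝ} (hδ : 0 < δ) (ω : Space d)
    (g : 𝓢(SpaceTime d, ℂ)) {z : SpaceTime d}
    (hz : 𝓕 (weightMul φ δ (schwartzProj χ δ ω g)) z ≠ 0) :
    (∀ i, |z.fst i - ω i| ≤ 2 * δ) ∧
      |z.snd - 2 * ⟪ω, z.fst - ω⟫ - ‖ω‖ ^ 2| ≤ (4 * d + 1) * δ ^ 2 := by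
  obtain ⟨s, hs, hne⟩ : ∃ s : ℝ, |s| ≤ δ ^ 2 ∧ 𝓕 (schwartzProj χ δ ω g) (z - pt 0 s) ≠ 0 := by
    by_contra hcon
    push Not at hcon
    exact hz (fourier_weightMul_eq_zero hφ hδ _ hcon)
  have hmem : z - pt 0 s ∈ plank 2 δ ω := by
    by_contra hcon
    exact hne (fourier_schwartzProj_eq_zero hd hχ hδ ω g hcon)
  have h2 : (z - pt 0 s).fst = z.fst := by simp [pt]
  have h3 : (z - pt 0 s).snd = z.snd - s := by simp [pt]
  rw [plank, Set.mem_ofPred_eq, h2, h3] at hmem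
  refine ⟨hmem.1, ?_⟩
  have h4 : |z.snd - 2 * ⟪ω, z.fst - ω⟫ - ‖ω‖ ^ 2| ≤
      |z.snd - s - 2 * ⟪ω, z.fst - ω⟫ - ‖ω‖ ^ 2| + |s| := by
    refine le_trans (le_of_eq ?_) (abs_add_le _ _)
    congr 1; ring
  linarith [hmem.2]

/-- Lowering the time exponent of the time-localized decoupling constant. -/
theorem exists_localConst_le_localConst (hd : 1 ≤ d) {χ : 𝓢(SpaceTime d, ℂ)} (hχ : IsCutoff χ)
    {φ : 𝓢(ℝ, ℝ)} (hφ : IsTimeWeight φ) {p q : ℝ≥0∞} (hp : 1 ≤ p) (hpq : p < q) :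
    ∃ C : ℝ≥0, ∀ r : ℝ≥0∞, 1 ≤ r → ∀ δ : ℝ, 0 < δ →
      localConst χ φ p r δ ≤ C * localConst χ φ q r δ := by
  obtain ⟨C, hC⟩ := exists_bernstein_const d hp hpq
  refine ⟨C + 1, fun r hr δ hδ => le_mul_of_forall_gt (by positivity) fun D hD =>
    localConst_le fun Ξ hΞ g hg => ?_⟩
  have hδ2 : 0 < δ ^ 2 := by positivity
  set α := 1 / p.toReal - 1 / q.toReal
  set lam := ENNReal.ofReal (δ ^ 2) with hlam
  have hlam0 : lam ≠ 0 := by simpa [hlam] using hδ.ne'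
  set F : 𝓢(SpaceTime d, ℂ) := ∑ ω ∈ Ξ, schwartzProj χ δ ω g with hF
  have hFc : (fun z => ∑ ω ∈ Ξ, smoothProj χ δ ω g z) = F := by
    funext z
    rw [hF, sum_apply]
    simp only [coe_schwartzProj]
  have hpiece : ∀ ω ∈ Ξ, mixedNorm q r Set.univ (weightMul φ δ (schwartzProj χ δ ω g)) ≤
      ((C + 1 : ℝ≥0) * lam ^ α) *
        mixedNorm p r Set.univ (weightMul φ δ (schwartzProj χ δ ω g)) := fun ω _ => by
    refine (hC r hr δ hδ ω _ fun z hz => ?_).trans ?_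
    · by_contra hne
      exact hz.not_ge (mem_slab_of_fourier_weightMul_ne_zero hd hχ hφ hδ ω g hne).2
    · rw [mul_assoc]
      gcongr
      simp
  have hvol : volume.restrict (Set.Icc 0 (δ ^ 2)⁻¹) Set.univ = lam⁻¹ := by
    rw [Measure.restrict_apply_univ, Real.volume_Icc, sub_zero, hlam,
      ENNReal.ofReal_inv_of_pos hδ2]
  calc mixedNorm p r (Set.Icc 0 (δ ^ 2)⁻¹) (fun z => ∑ ω ∈ Ξ, smoothProj χ δ ω g z)
      -- Hölder on an interval of length `lam⁻¹`; its loss `lam⁻¹ ^ α` cancels the Bernstein gain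
      -- `lam ^ α` in `hpiece`.
      ≤ mixedNorm q r (Set.Icc 0 (δ ^ 2)⁻¹) (fun z => ∑ ω ∈ Ξ, smoothProj χ δ ω g z) *
          lam⁻¹ ^ α := by
        rw [hFc, ← hvol]
        exact eLpNorm_le_eLpNorm_mul_rpow_measure_univ hpq.le
          (measurable_sliceNorm r F.continuous).aestronglyMeasurable
    _ ≤ (D * (((C + 1 : ℝ≥0) * lam ^ α) * ell2 Ξ fun ω =>
          mixedNorm p r Set.univ (weightMul φ δ (schwartzProj χ δ ω g)))) * lam⁻¹ ^ α := by
        refine mul_le_mul' ((local_decoupling_of_lt hD hΞ g hg).trans ?_) le_rfl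
        exact mul_le_mul' le_rfl (ell2_le_mul hpiece)
    _ = (C + 1 : ℝ≥0) * D * (ell2 Ξ fun ω =>
          mixedNorm p r Set.univ (weightMul φ δ (schwartzProj χ δ ω g))) *
            (lam ^ α * lam⁻¹ ^ α) := by ring
    _ = _ := by
        rw [ENNReal.inv_rpow, ENNReal.mul_inv_cancel, mul_one]
        · exact (ENNReal.rpow_pos (pos_iff_ne_zero.2 hlam0) ENNReal.ofReal_ne_top).ne'
        · exact ENNReal.rpow_ne_top_of_ne_zero hlam0 ENNReal.ofReal_ne_top

/-! ### Colouring the frequencies and passing to scale `2δ` -/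

/-- The residue class modulo `4 d + 1` of the cell of side `50 δ` containing a point. -/
def cellColor (δ : ℝ) (ω : Space d) : Fin d → ZMod (4 * d + 1) :=
  fun i => (⌊ω i / (50 * δ)⌋ : ℤ)

theorem dist_le_sqrt_mul {x y : Space d} {a : ℝ} (ha : 0 ≤ a) (h : ∀ i, |x i - y i| ≤ a) :
    dist x y ≤ √(d : ℝ) * a := by
  rw [EuclideanSpace.dist_eq]
  refine Real.sqrt_le_iff.2 ⟨by positivity, ?_⟩
  calc ∑ i, dist (x i) (y i) ^ 2 ≤ ∑ _i : Fin d, a ^ 2 := Finset.sum_le_sum fun i _ =>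
        pow_le_pow_left₀ dist_nonneg (h i) 2
    _ = (√(d : ℝ) * a) ^ 2 := by
        rw [mul_pow, Real.sq_sqrt (Nat.cast_nonneg d)]
        simp

theorem abs_sub_le_dist (x y : Space d) (i : Fin d) : |x i - y i| ≤ dist x y := by
  rw [dist_eq_norm]
  exact PiLp.norm_apply_le (x - y) i

/-- Separated points in cells of the same residue class are twice as far apart. -/
theorem two_mul_le_dist_of_cellColor_eq (hd : 1 ≤ d) {δ : ℝ} (hδ : 0 < δ) {ω ω' : Space d}
    (hsep : 100 * √(d : ℝ) * δ ≤ dist ω ω') (hc : cellColor δ ω = cellColor δ ω') :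
    100 * √(d : ℝ) * (2 * δ) ≤ dist ω ω' := by
  have hd1 : (1 : ℝ) ≤ d := by exact_mod_cast hd
  have hsd : 1 ≤ √(d : ℝ) := Real.one_le_sqrt.2 hd1
  have hsq : √(d : ℝ) ^ 2 = d := Real.sq_sqrt (by linarith)
  have h50 : 0 < 50 * δ := by linarith
  -- Points of one cell lie within `50√d δ`, contradicting separation. Distinct cells of one colour
  -- have indices at least `4d + 1` apart in some coordinate, so the points differ there by at least
  -- `4d · 50δ = 200dδ ≥ 200√d δ`.
  by_cases hfl : ∀ i, ⌊ω i / (50 * δ)⌋ = ⌊ω' i / (50 * δ)⌋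
  · exfalso
    have : dist ω ω' ≤ √(d : ℝ) * (50 * δ) := dist_le_sqrt_mul h50.le fun i => by
      have := (Int.abs_sub_lt_one_of_floor_eq_floor (hfl i)).le
      rw [← sub_div, abs_div, abs_of_pos h50, div_le_one h50] at this
      exact this
    nlinarith
  · push Not at hfl
    obtain ⟨i, hi⟩ := hfl
    have hmod : ((4 * d + 1 : ℕ) : ℤ) ∣ ⌊ω' i / (50 * δ)⌋ - ⌊ω i / (50 * δ)⌋ :=
      (ZMod.intCast_eq_intCast_iff_dvd_sub _ _ _).1 (congrFun hc i)
    have hle : (4 * d + 1 : ℤ) ≤ |⌊ω' i / (50 * δ)⌋ - ⌊ω i / (50 * δ)⌋| := by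
      have := Int.le_of_dvd (abs_pos.2 (sub_ne_zero.2 (Ne.symm hi))) ((dvd_abs _ _).2 hmod)
      exact_mod_cast this
    have hle' : (4 * d + 1 : ℝ) ≤
        |(⌊ω' i / (50 * δ)⌋ : ℝ) - (⌊ω i / (50 * δ)⌋ : ℝ)| := by exact_mod_cast hle
    have h4 : (4 * d : ℝ) ≤ |ω' i / (50 * δ) - ω i / (50 * δ)| := by
      have a1 := Int.floor_le (ω i / (50 * δ))
      have a2 := Int.lt_floor_add_one (ω i / (50 * δ))
      have b1 := Int.floor_le (ω' i / (50 * δ))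
      have b2 := Int.lt_floor_add_one (ω' i / (50 * δ))
      rcases le_abs.1 hle' with h | h
      · exact le_abs.2 (Or.inl (by linarith))
      · exact le_abs.2 (Or.inr (by linarith))
    rw [← sub_div, abs_div, abs_of_pos h50, le_div_iff₀ h50] at h4
    have h5 := abs_sub_le_dist ω' ω i
    rw [dist_comm] at h5
    nlinarith

theorem mixedNorm_sum_le {ι : Type*} (s : Finset ι) {q r : ℝ≥0∞} (hq : 1 ≤ q) (hr : 1 ≤ r)
    (I : Set ℝ) (f : ι → 𝓢(SpaceTime d, ℂ)) :
    mixedNorm q r I (fun p => ∑ i ∈ s, f i p) ≤ ∑ i ∈ s, mixedNorm q r I (f i) := by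
  calc mixedNorm q r I (fun p => ∑ i ∈ s, f i p)
      ≤ eLpNorm (∑ i ∈ s, sliceNorm r (f i)) q (volume.restrict I) := by
        refine eLpNorm_mono_enorm fun t => ?_
        have h := eLpNorm_sum_le (p := r) (s := s) (μ := (volume : Measure (Space d)))
          (f := fun i x => f i (pt x t))
          (fun i _ => (continuous_slice (f i).continuous t).aestronglyMeasurable) hr
        simp only [enorm_eq_self, Finset.sum_apply]
        refine le_trans (le_of_eq ?_) h
        congr 1
        funext x
        simp
    _ ≤ _ := eLpNorm_sum_le
        (fun i _ => (measurable_sliceNorm r (f i).continuous).aestronglyMeasurable) hq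

theorem isAdmissible_filter_cellColor (hd : 1 ≤ d) {δ : ℝ} (hδ : 0 < δ)
    {Ξ : Finset (Space d)} (hΞ : IsAdmissible δ Ξ) (k : Fin d → ZMod (4 * d + 1)) :
    IsAdmissible (2 * δ) (Ξ.filter fun ω => cellColor δ ω = k) := by
  refine ⟨fun ω hω => hΞ.1 ω (Finset.mem_filter.1 hω).1, fun ω hω ω' hω' hne => ?_⟩
  rw [Finset.mem_filter] at hω hω'
  exact two_mul_le_dist_of_cellColor_eq hd hδ (hΞ.2 ω hω.1 ω' hω'.1 hne) (hω.2.trans hω'.2.symm)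

section Reassembly

variable {χ : 𝓢(SpaceTime d, ℂ)} {φ : 𝓢(ℝ, ℝ)} {δ : ℝ}

theorem fourier_sum_weightMul (Ξ : Finset (Space d)) (g : 𝓢(SpaceTime d, ℂ)) (p : SpaceTime d) :
    𝓕 (∑ ω ∈ Ξ, weightMul φ δ (schwartzProj χ δ ω g)) p =
      ∑ ω ∈ Ξ, 𝓕 (weightMul φ δ (schwartzProj χ δ ω g)) p := by
  rw [FourierTransform.fourier_sum, sum_apply]

/-- At scale `2δ` the half-thickness of `θ_ω` is `2d(2δ)² = 8dδ²`, which exceeds `(4d + 1)δ²` since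
`d ≥ 1`. The undilated plank is where `χ ∘ A_ω` equals 1. -/
theorem mem_plank_of_fourier_weightMul_ne_zero (hd : 1 ≤ d) (hχ : IsCutoff χ)
    (hφ : IsTimeWeight φ) (hδ : 0 < δ) (ω : Space d) (g : 𝓢(SpaceTime d, ℂ)) {z : SpaceTime d}
    (hz : 𝓕 (weightMul φ δ (schwartzProj χ δ ω g)) z ≠ 0) : z ∈ plank 1 (2 * δ) ω := by
  have hd1 : (1 : ℝ) ≤ d := by exact_mod_cast hd
  obtain ⟨h1, h2⟩ := mem_slab_of_fourier_weightMul_ne_zero hd hχ hφ hδ ω g hz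
  refine ⟨fun i => by simpa using h1 i, h2.trans ?_⟩
  nlinarith [sq_nonneg δ]

theorem plank_subset_plank {κ κ' : ℝ} (h : κ ≤ κ') (hδ : 0 ≤ δ) (ω : Space d) :
    plank κ δ ω ⊆ plank κ' δ ω := fun z hz =>
  ⟨fun i => (hz.1 i).trans (by gcongr), hz.2.trans (by gcongr)⟩

theorem hasFourierSupport_sum_weightMul (hd : 1 ≤ d) (hχ : IsCutoff χ) (hφ : IsTimeWeight φ)
    (hδ : 0 < δ) (Ξ : Finset (Space d)) (g : 𝓢(SpaceTime d, ℂ)) :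
    HasFourierSupport (2 * δ) Ξ
      (∑ ω ∈ Ξ, weightMul φ δ (schwartzProj χ δ ω g) : 𝓢(SpaceTime d, ℂ)) := by
  intro z hz
  rw [Function.mem_support, ← SchwartzMap.fourier_coe, fourier_sum_weightMul] at hz
  obtain ⟨ω, hω, hne⟩ := Finset.exists_ne_zero_of_sum_ne_zero hz
  exact Set.mem_biUnion hω (plank_subset_plank one_le_two (by linarith) ω
    (mem_plank_of_fourier_weightMul_ne_zero hd hχ hφ hδ ω g hne))

/-- At scale `2 δ` the smoothed projections recover the individual pieces `f_ω φ`. -/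
theorem smoothProj_sum_weightMul (hd : 1 ≤ d) (hχ : IsCutoff χ) (hφ : IsTimeWeight φ)
    (hδ : 0 < δ) {Ξ : Finset (Space d)} (hΞ : IsAdmissible (2 * δ) Ξ)
    (g : 𝓢(SpaceTime d, ℂ)) {ω : Space d} (hω : ω ∈ Ξ) :
    smoothProj χ (2 * δ) ω (∑ ω ∈ Ξ, weightMul φ δ (schwartzProj χ δ ω g) : 𝓢(SpaceTime d, ℂ)) =
      weightMul φ δ (schwartzProj χ δ ω g) := by
  have hd1 : (1 : ℝ) ≤ d := by exact_mod_cast hd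
  have hsd : 1 ≤ √(d : ℝ) := Real.one_le_sqrt.2 hd1
  have h2δ : 0 < 2 * δ := by linarith
  have key : (fun p => 𝓕 (⇑(∑ ω ∈ Ξ, weightMul φ δ (schwartzProj χ δ ω g) :
      𝓢(SpaceTime d, ℂ))) p * χ (rescale (2 * δ) ω p)) =
      ⇑(𝓕 (weightMul φ δ (schwartzProj χ δ ω g)) : 𝓢(SpaceTime d, ℂ)) := by
    funext p
    rw [← SchwartzMap.fourier_coe, fourier_sum_weightMul, Finset.sum_mul,
      Finset.sum_eq_single_of_mem ω hω]
    · by_cases h0 : 𝓕 (weightMul φ δ (schwartzProj χ δ ω g)) p = 0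
      · rw [h0, zero_mul]
      · rw [hχ.1 _ ((rescale_mem_cube_iff hd h2δ ω p).2
          (mem_plank_of_fourier_weightMul_ne_zero hd hχ hφ hδ ω g h0)), mul_one]
    -- Overlap of the spectrum at `ω'` with the cutoff at `ω` would force coordinates within `2δ +
    -- 4δ`, far below the separation `200√d δ`.
    · intro ω' hω' hne
      by_contra hcon
      have h1 := mem_plank_of_fourier_weightMul_ne_zero hd hχ hφ hδ ω' g (left_ne_zero_of_mul hcon)
      have h2 : p ∈ plank 2 (2 * δ) ω := by
        by_contra hp
        exact right_ne_zero_of_mul hcon (hχ.2 _ (mt (rescale_mem_cube_iff hd h2δ ω p).1 hp))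
      have h3 : dist ω' ω ≤ √(d : ℝ) * (6 * δ) := dist_le_sqrt_mul (by linarith) fun i => by
        have e1 := abs_le.1 (h1.1 i)
        have e2 := abs_le.1 (h2.1 i)
        exact abs_le.2 ⟨by linarith, by linarith⟩
      have h4 := hΞ.2 ω' hω' ω hω hne
      nlinarith
  rw [smoothProj, key, ← SchwartzMap.fourierInv_coe,
    FourierTransform.fourierInv_fourier_eq (F := 𝓢(SpaceTime d, ℂ))]

/-- For `t` in `[0, δ⁻²]` the argument `δ² t - 1/2` lies in `[-1/2, 1/2]`, where `φ ≥ 1`. -/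
theorem mixedNorm_Icc_le_weighted (hφ : IsTimeWeight φ) (hδ : 0 < δ) (q r : ℝ≥0∞)
    (f : 𝓢(SpaceTime d, ℂ)) :
    mixedNorm q r (Set.Icc 0 (δ ^ 2)⁻¹) f ≤ mixedNorm q r Set.univ (weightMul φ δ f) := by
  have hδ2 : 0 < δ ^ 2 := by positivity
  refine le_trans (eLpNorm_mono_enorm_ae (g := sliceNorm r (weightMul φ δ f)) ?_)
    (eLpNorm_mono_measure _ (Measure.restrict_mono (Set.subset_univ _) le_rfl))
  filter_upwards [ae_restrict_mem measurableSet_Icc] with t ht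
  rw [enorm_eq_self, enorm_eq_self]
  refine eLpNorm_mono fun x => ?_
  rw [weightMul_apply, norm_mul]
  refine le_mul_of_one_le_right (norm_nonneg _) ?_
  have h1 : 1 ≤ adapted φ 0 (δ ^ 2)⁻¹ t := by
    rw [adapted_eq φ δ t hδ]
    have h2 : δ ^ 2 * t ≤ 1 := by
      calc δ ^ 2 * t ≤ δ ^ 2 * (δ ^ 2)⁻¹ := by gcongr; exact ht.2
        _ = 1 := mul_inv_cancel₀ hδ2.ne'
    have h3 : 0 ≤ δ ^ 2 * t := mul_nonneg hδ2.le ht.1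
    have h4 := hφ.2.1 (δ ^ 2 * t - 1 / 2)
    rwa [Set.indicator_of_mem (Set.mem_Icc.2 ⟨by linarith, by linarith⟩)] at h4
  rw [show (pt x t).snd = t from rfl, Complex.norm_real]
  exact h1.trans (le_abs_self _)

end Reassembly

/-- The time-localized decoupling constant is controlled by the global one at scale `2 δ`. -/
theorem exists_localConst_le_globalConst (hd : 1 ≤ d) {χ : 𝓢(SpaceTime d, ℂ)} (hχ : IsCutoff χ)
    {φ : 𝓢(ℝ, ℝ)} (hφ : IsTimeWeight φ) :
    ∃ C : ℝ≥0, ∀ q r : ℝ≥0∞, 1 ≤ q → 1 ≤ r → ∀ δ : ℝ, 0 < δ →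
      localConst χ φ q r δ ≤ C * globalConst χ q r (2 * δ) := by
  -- The constant is the number of colours, paid in the triangle inequality over colour classes.
  refine ⟨Fintype.card (Fin d → ZMod (4 * d + 1)), fun q r hq hr δ hδ =>
    le_mul_of_forall_gt (by simp) fun D hD => localConst_le fun Ξ hΞ g _ => ?_⟩
  set w : Space d → 𝓢(SpaceTime d, ℂ) := fun ω => weightMul φ δ (schwartzProj χ δ ω g) with hw
  set F : 𝓢(SpaceTime d, ℂ) := ∑ ω ∈ Ξ, schwartzProj χ δ ω g with hF
  have hFc : (fun z => ∑ ω ∈ Ξ, smoothProj χ δ ω g z) = F := by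
    funext z
    rw [hF, sum_apply]
    simp only [coe_schwartzProj]
  have hFw : ⇑(weightMul φ δ F) = fun z => ∑ k, (∑ ω ∈ Ξ with cellColor δ ω = k, w ω) z := by
    funext z
    simp only [weightMul_apply, hF, hw, sum_apply, Finset.sum_mul]
    rw [Finset.sum_fiberwise]
  calc mixedNorm q r (Set.Icc 0 (δ ^ 2)⁻¹) (fun z => ∑ ω ∈ Ξ, smoothProj χ δ ω g z)
      ≤ mixedNorm q r Set.univ (weightMul φ δ F) := by
        rw [hFc]; exact mixedNorm_Icc_le_weighted hφ hδ q r F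
    _ ≤ ∑ k, mixedNorm q r Set.univ
          (∑ ω ∈ Ξ with cellColor δ ω = k, w ω : 𝓢(SpaceTime d, ℂ)) := by
        rw [hFw]
        exact mixedNorm_sum_le _ hq hr _ _
    _ ≤ ∑ _k : Fin d → ZMod (4 * d + 1),
          D * ell2 Ξ fun ω => mixedNorm q r Set.univ (w ω) := by
        refine Finset.sum_le_sum fun k _ => ?_
        have hadm := isAdmissible_filter_cellColor hd hδ hΞ k
        have hproj : ∀ ω ∈ Ξ.filter fun ω => cellColor δ ω = k, smoothProj χ (2 * δ) ω
            (∑ ω ∈ Ξ with cellColor δ ω = k, w ω : 𝓢(SpaceTime d, ℂ)) = w ω := fun ω hω =>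
          smoothProj_sum_weightMul hd hχ hφ hδ hadm g hω
        have := global_decoupling_of_lt hD hadm _
          (hasFourierSupport_sum_weightMul hd hχ hφ hδ _ g)
        rw [ell2_congr fun ω hω => by rw [hproj ω hω]] at this
        refine le_trans (le_of_eq ?_)
          (this.trans (mul_le_mul' le_rfl (ell2_mono (Finset.filter_subset _ _))))
        congr 1
        funext z
        rw [sum_apply]
        exact Finset.sum_congr rfl fun ω hω => by rw [hproj ω hω]
    _ = _ := by
        rw [Finset.sum_const, Finset.card_univ, nsmul_eq_mul, mul_assoc]
        simp [hw]

/-! ### Summation over the time tiles -/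

section Lattice

/-- For finite `q` this is additivity of the integral in the measure; for `q = ∞`, a property
holding almost everywhere for each `μ k` does so for the sum. -/
theorem eLpNorm_sum_measure_le {α ι : Type*} [MeasurableSpace α] [MeasurableSpace ι]
    [DiscreteMeasurableSpace ι] [Countable ι] (μ : ι → Measure α) (N : α → ℝ≥0∞) {q : ℝ≥0∞}
    (hq0 : q ≠ 0) :
    eLpNorm N q (Measure.sum μ) ≤ eLpNorm (fun k => eLpNorm N q (μ k)) q Measure.count := by
  rcases eq_or_ne q ∞ with rfl | hq
  · simp only [eLpNorm_exponent_top]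
    refine essSup_le_of_ae_le _ ((Measure.ae_sum_iff (μ := μ)).2 fun k => ?_)
    have h1 : eLpNormEssSup N (μ k) ≤
        eLpNormEssSup (fun k => eLpNormEssSup N (μ k)) Measure.count := by
      have := enorm_ae_le_eLpNormEssSup (fun k => eLpNormEssSup N (μ k)) Measure.count
      simpa using Measure.ae_count_iff.1 this k
    filter_upwards [enorm_ae_le_eLpNormEssSup N (μ k)] with x hx
    exact hx.trans h1
  · have hpos : q.toReal ≠ 0 := (ENNReal.toReal_pos hq0 hq).ne'
    simp only [eLpNorm_eq_lintegral_rpow_enorm_toReal hq0 hq, enorm_eq_self,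
      lintegral_sum_measure, lintegral_count, ← ENNReal.rpow_mul, one_div,
      inv_mul_cancel₀ hpos, ENNReal.rpow_one, le_refl]

/-- Each `W k ≤ C`, so `W k ^ q ≤ C ^ (q - 1) * W k` and the `q`-th powers sum to at most `C ^ q`.
After Tonelli and a `q`-th root the constant is `C`, independent of `q`. -/
theorem eLpNorm_count_mul_le {N : ℝ → ℝ≥0∞} (hN : Measurable N) {W : ℤ → ℝ → ℝ≥0∞}
    (hW : ∀ k, Measurable (W k)) {C : ℝ≥0∞} (hC : ∀ t, ∑' k, W k t ≤ C) {q : ℝ≥0∞}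
    (hq1 : 1 ≤ q) :
    eLpNorm (fun k => eLpNorm (fun t => W k t * N t) q volume) q Measure.count ≤
      C * eLpNorm N q volume := by
  have hWC : ∀ k t, W k t ≤ C := fun k t => (ENNReal.le_tsum k).trans (hC t)
  have hq0 : q ≠ 0 := (zero_lt_one.trans_le hq1).ne'
  rcases eq_or_ne q ∞ with rfl | hq
  · simp only [eLpNorm_exponent_top]
    refine essSup_le_of_ae_le _ (Filter.Eventually.of_forall fun k => ?_)
    simp only [enorm_eq_self]
    refine essSup_le_of_ae_le _ ?_
    filter_upwards [enorm_ae_le_eLpNormEssSup N volume] with t ht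
    exact mul_le_mul' (hWC k t) ht
  · have hq1r : 1 ≤ q.toReal := by simpa using ENNReal.toReal_mono hq hq1
    have hpos : q.toReal ≠ 0 := by linarith
    have hinv : (0 : ℝ) ≤ q.toReal⁻¹ := by positivity
    have hsum : ∀ t, ∑' k, W k t ^ q.toReal ≤ C ^ q.toReal := fun t => by
      calc ∑' k, W k t ^ q.toReal ≤ ∑' k, C ^ (q.toReal - 1) * W k t := by
            refine ENNReal.tsum_le_tsum fun k => ?_
            calc W k t ^ q.toReal = W k t ^ ((q.toReal - 1) + 1) := by ring_nf
              _ = W k t ^ (q.toReal - 1) * W k t := by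
                rw [ENNReal.rpow_add_of_nonneg _ _ (by linarith) zero_le_one, ENNReal.rpow_one]
              _ ≤ _ := mul_le_mul' (ENNReal.rpow_le_rpow (hWC k t) (by linarith)) le_rfl
        _ ≤ C ^ (q.toReal - 1) * C := by
            rw [ENNReal.tsum_mul_left]
            exact mul_le_mul' le_rfl (hC t)
        _ = C ^ ((q.toReal - 1) + 1) := by
            rw [ENNReal.rpow_add_of_nonneg _ _ (by linarith) zero_le_one, ENNReal.rpow_one]
        _ = _ := by ring_nf
    simp only [eLpNorm_eq_lintegral_rpow_enorm_toReal hq0 hq, enorm_eq_self,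
      lintegral_count, ← ENNReal.rpow_mul, one_div, inv_mul_cancel₀ hpos, ENNReal.rpow_one]
    calc (∑' k, ∫⁻ t, (W k t * N t) ^ q.toReal) ^ q.toReal⁻¹
        = (∫⁻ t, (∑' k, W k t ^ q.toReal) * N t ^ q.toReal) ^ q.toReal⁻¹ := by
          rw [← lintegral_tsum (f := fun k t => (W k t * N t) ^ q.toReal)
            fun k => (((hW k).mul hN).pow_const _).aemeasurable]
          congr 1
          refine lintegral_congr fun t => ?_
          rw [← ENNReal.tsum_mul_right]
          exact tsum_congr fun k => ENNReal.mul_rpow_of_nonneg _ _ (by linarith)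
      _ ≤ (∫⁻ t, C ^ q.toReal * N t ^ q.toReal) ^ q.toReal⁻¹ :=
          ENNReal.rpow_le_rpow (lintegral_mono fun t => mul_le_mul' (hsum t) le_rfl) hinv
      _ = _ := by
          rw [lintegral_const_mul _ (hN.pow_const _), ENNReal.mul_rpow_of_nonneg _ _ hinv,
            ← ENNReal.rpow_mul, mul_inv_cancel₀ hpos, ENNReal.rpow_one]

/-- After squaring, this is the triangle inequality in `L^{q/2}`, which is where `q ≥ 2` is needed.
-/
theorem eLpNorm_ell2_le {α ι : Type*} [MeasurableSpace α] {μ : Measure α} (s : Finset ι)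
    {B : ι → α → ℝ≥0∞} (hB : ∀ i, Measurable (B i)) {q : ℝ≥0∞} (hq : 2 ≤ q) :
    eLpNorm (fun k => ell2 s fun i => B i k) q μ ≤ ell2 s fun i => eLpNorm (B i) q μ := by
  set p := q * ENNReal.ofReal (1 / 2) with hp
  have hp1 : 1 ≤ p := by
    calc (1 : ℝ≥0∞) = 2 * ENNReal.ofReal (1 / 2) := by
          rw [← ENNReal.ofReal_ofNat, ← ENNReal.ofReal_mul (by norm_num)]; norm_num
      _ ≤ p := mul_le_mul' hq le_rfl
  have hp2 : p * ENNReal.ofReal 2 = q := by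
    rw [hp, mul_assoc, ← ENNReal.ofReal_mul (by norm_num)]; norm_num
  have h1 := eLpNorm_enorm_rpow (p := q) (μ := μ) (fun k => ∑ i ∈ s, B i k ^ 2)
    (q := 1 / 2) (by norm_num)
  simp only [enorm_eq_self] at h1
  simp only [ell2]
  rw [h1]
  refine ENNReal.rpow_le_rpow ?_ (by norm_num)
  have h2 := eLpNorm_sum_le (p := p) (μ := μ) (s := s) (f := fun i k => B i k ^ 2)
    (fun i _ => ((hB i).pow_const 2).aestronglyMeasurable) hp1
  have h3 : ∀ i, eLpNorm (fun k => B i k ^ 2) p μ = eLpNorm (B i) q μ ^ 2 := fun i => by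
    have := eLpNorm_enorm_rpow (p := p) (μ := μ) (B i) (q := 2) (by norm_num)
    rw [hp2] at this
    simpa using this
  simp only [h3] at h2
  refine le_trans (le_of_eq ?_) h2
  congr 1
  funext k
  simp

/-- Shifting the index by `⌊y⌋` replaces `y` by its fractional part, and quadratic decay of `φ`
gives a summable bound uniform in `y`. -/
theorem exists_tsum_enorm_sub_intCast_le (φ : 𝓢(ℝ, ℝ)) :
    ∃ C : ℝ≥0, ∀ y : ℝ, ∑' k : ℤ, ‖φ (y - k)‖ₑ ≤ C := by
  obtain ⟨K₀, -, hK₀⟩ := φ.decay 0 0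
  obtain ⟨K₂, -, hK₂⟩ := φ.decay 2 0
  simp only [pow_zero, one_mul, norm_iteratedFDeriv_zero] at hK₀ hK₂
  have hdecay : ∀ (y : ℝ) (j : ℤ), ‖φ (Int.fract y - j)‖ ≤ 3 * (K₀ + K₂) * (1 / (1 + (j : ℝ) ^ 2)) :=
    fun y j => by
      have h0 := Int.fract_nonneg y
      have h1 := (Int.fract_lt_one y).le
      set x := Int.fract y - j with hx
      -- From `j = fract y - x` with `0 ≤ fract y ≤ 1` one gets `j² ≤ 2x² + 2`.
      have h2 : (1 + (j : ℝ) ^ 2) ≤ 3 * (1 + x ^ 2) := by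
        rw [hx]
        nlinarith [sq_nonneg (2 * Int.fract y - j), mul_nonneg h0 (sub_nonneg.2 h1),
          sq_nonneg (Int.fract y - j)]
      have h3 : (1 + x ^ 2) * ‖φ x‖ ≤ K₀ + K₂ := by
        have a := hK₀ x
        have b := hK₂ x
        rw [Real.norm_eq_abs x, sq_abs] at b
        linarith
      rw [mul_one_div, le_div_iff₀ (by positivity)]
      nlinarith [norm_nonneg (φ x)]
  have hsum : Summable fun j : ℤ => 3 * (K₀ + K₂) * (1 / (1 + (j : ℝ) ^ 2)) := by
    refine Summable.mul_left _ ?_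
    refine (Summable.of_norm_bounded_eventually (Real.summable_one_div_int_pow.2 one_lt_two) ?_)
    filter_upwards [(Set.finite_singleton (0 : ℤ)).compl_mem_cofinite] with j hj
    have hj' : (0 : ℝ) < (j : ℝ) ^ 2 := by
      have : (j : ℝ) ≠ 0 := by exact_mod_cast hj
      positivity
    rw [Real.norm_of_nonneg (by positivity)]
    exact one_div_le_one_div_of_le hj' (by linarith)
  refine ⟨Real.toNNReal (∑' j : ℤ, 3 * (K₀ + K₂) * (1 / (1 + (j : ℝ) ^ 2))), fun y => ?_⟩
  have hnn : ∀ j : ℤ, 0 ≤ 3 * (K₀ + K₂) * (1 / (1 + (j : ℝ) ^ 2)) := fun j =>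
    (norm_nonneg _).trans (hdecay 0 j)
  calc ∑' k : ℤ, ‖φ (y - k)‖ₑ = ∑' j : ℤ, ‖φ (y - ((⌊y⌋ + j : ℤ) : ℝ))‖ₑ :=
        ((Equiv.addLeft ⌊y⌋).tsum_eq fun k : ℤ => ‖φ (y - k)‖ₑ).symm
    _ ≤ ∑' j : ℤ, ENNReal.ofReal (3 * (K₀ + K₂) * (1 / (1 + (j : ℝ) ^ 2))) := by
        refine ENNReal.tsum_le_tsum fun j => ?_
        rw [← ofReal_norm]
        refine ENNReal.ofReal_le_ofReal (le_trans (le_of_eq ?_) (hdecay y j))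
        congr 2
        rw [Int.fract]
        push_cast
        ring
    _ = _ := (ENNReal.ofReal_tsum_of_nonneg hnn hsum).symm

end Lattice

/-! ### Time translations -/

section Translation

/-- Translation in time of a Schwartz function. -/
def timeShift (τ : ℝ) (g : 𝓢(SpaceTime d, ℂ)) : 𝓢(SpaceTime d, ℂ) :=
  g.compSubConstCLM ℂ (-pt 0 τ)

theorem timeShift_apply (τ : ℝ) (g : 𝓢(SpaceTime d, ℂ)) (p : SpaceTime d) :
    timeShift τ g p = g (p + pt 0 τ) := by
  simp [timeShift]

theorem fourier_timeShift (τ : ℝ) (g : 𝓢(SpaceTime d, ℂ)) (p : SpaceTime d) :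
    𝓕 (⇑(timeShift τ g)) p = Real.fourierChar ⟪(pt 0 τ : SpaceTime d), p⟫ * 𝓕 (⇑g) p := by
  rw [← fourier_comp_add_right, ← funext (timeShift_apply τ g)]

theorem hasFourierSupport_timeShift {δ : ℝ} {Ξ : Finset (Space d)} {g : 𝓢(SpaceTime d, ℂ)}
    (hg : HasFourierSupport δ Ξ g) (τ : ℝ) : HasFourierSupport δ Ξ (timeShift τ g) := by
  intro p hp
  rw [Function.mem_support, fourier_timeShift] at hp
  exact hg (right_ne_zero_of_mul hp)

/-- Translation is multiplication by a character on the frequency side, so it commutes with the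
multiplier. -/
theorem schwartzProj_timeShift (χ : 𝓢(SpaceTime d, ℂ)) (δ : ℝ) (ω : Space d) (τ : ℝ)
    (g : 𝓢(SpaceTime d, ℂ)) :
    schwartzProj χ δ ω (timeShift τ g) = timeShift τ (schwartzProj χ δ ω g) := by
  ext p
  rw [timeShift_apply, coe_schwartzProj, coe_schwartzProj, smoothProj, smoothProj,
    ← fourierInv_fourierChar_mul]
  simp only [fourier_timeShift, mul_assoc]

theorem sliceNorm_timeShift (r : ℝ≥0∞) (τ : ℝ) (f : 𝓢(SpaceTime d, ℂ)) (t : ℝ) :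
    sliceNorm r (timeShift τ f) t = sliceNorm r f (t + τ) := by
  rw [sliceNorm, sliceNorm]
  congr 1
  funext x
  rw [timeShift_apply]
  congr 1
  refine (WithLp.ofLp_injective 2) (Prod.ext ?_ ?_) <;> simp [pt]

theorem sliceNorm_weightMul (φ : 𝓢(ℝ, ℝ)) {δ : ℝ} (hδ : 0 < δ) (r : ℝ≥0∞)
    (f : 𝓢(SpaceTime d, ℂ)) (t : ℝ) :
    sliceNorm r (weightMul φ δ f) t = ‖φ (δ ^ 2 * t - 1 / 2)‖ₑ * sliceNorm r f t := by
  have h1 : (fun x : Space d => weightMul φ δ f (pt x t)) =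
      φ (δ ^ 2 * t - 1 / 2) • fun x : Space d => f (pt x t) := by
    funext x
    rw [weightMul_apply, Pi.smul_apply, Complex.real_smul, mul_comm, adapted_eq φ δ _ hδ]
    rfl
  rw [sliceNorm, h1, eLpNorm_const_smul]
  rfl

theorem mixedNorm_timeShift_Icc (q r : ℝ≥0∞) (L τ : ℝ) (f : 𝓢(SpaceTime d, ℂ)) :
    mixedNorm q r (Set.Icc 0 L) (timeShift τ f) =
      eLpNorm (sliceNorm r f) q (volume.restrict (Set.Icc τ (τ + L))) := by
  have hmp : MeasurePreserving (fun t : ℝ => t + τ) (volume.restrict (Set.Icc 0 L))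
      (volume.restrict (Set.Icc τ (τ + L))) := by
    have := (measurePreserving_add_right volume τ).restrict_preimage
      (measurableSet_Icc (a := τ) (b := τ + L))
    simpa using this
  rw [← eLpNorm_comp_measurePreserving
    (measurable_sliceNorm r f.continuous).aestronglyMeasurable hmp]
  exact congrArg (fun N => eLpNorm N q _) (funext fun t => sliceNorm_timeShift r τ f t)

/-- Translating time by `k δ⁻²` moves the shift from the function to the weight, whose argument
drops by `k`; the weights can then be summed over `k`. -/
theorem mixedNorm_weightMul_timeShift (φ : 𝓢(ℝ, ℝ)) {δ : ℝ} (hδ : 0 < δ) (q r : ℝ≥0∞) (k : ℤ)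
    (f : 𝓢(SpaceTime d, ℂ)) :
    mixedNorm q r Set.univ (weightMul φ δ (timeShift (k * (δ ^ 2)⁻¹) f)) =
      eLpNorm (fun t => ‖φ (δ ^ 2 * t - 1 / 2 - k)‖ₑ * sliceNorm r f t) q volume := by
  have hm : Measurable fun t => ‖φ (δ ^ 2 * t - 1 / 2 - k)‖ₑ * sliceNorm r f t := by
    refine Measurable.mul ?_ (measurable_sliceNorm r f.continuous)
    exact (φ.continuous.comp (by fun_prop)).enorm.measurable
  rw [← eLpNorm_comp_measurePreserving hm.aestronglyMeasurable
    (measurePreserving_add_right volume (k * (δ ^ 2)⁻¹)), mixedNorm, Measure.restrict_univ]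
  refine congrArg (fun N => eLpNorm N q _) (funext fun t => ?_)
  refine (sliceNorm_weightMul φ hδ r _ t).trans ?_
  rw [sliceNorm_timeShift, Function.comp_apply]
  congr 3
  have : δ ^ 2 ≠ 0 := by positivity
  field_simp
  ring

end Translation

/-- The global decoupling constant is controlled by the time-localized one. -/
theorem exists_globalConst_le_localConst (χ : 𝓢(SpaceTime d, ℂ)) (φ : 𝓢(ℝ, ℝ)) :
    ∃ C : ℝ≥0, ∀ q r : ℝ≥0∞, 2 ≤ q → ∀ δ : ℝ, 0 < δ →
      globalConst χ q r δ ≤ C * localConst χ φ q r δ := by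
  obtain ⟨C, hC⟩ := exists_tsum_enorm_sub_intCast_le φ
  refine ⟨C + 1, fun q r hq δ hδ => le_mul_of_forall_gt (by positivity) fun D hD =>
    globalConst_le fun Ξ hΞ g hg => ?_⟩
  have hq1 : 1 ≤ q := one_le_two.trans hq
  have hL : 0 < (δ ^ 2)⁻¹ := by positivity
  set L := (δ ^ 2)⁻¹ with hLdef
  set f : Space d → 𝓢(SpaceTime d, ℂ) := fun ω => schwartzProj χ δ ω g with hf
  set F : 𝓢(SpaceTime d, ℂ) := ∑ ω ∈ Ξ, f ω with hF
  have hFc : (fun z => ∑ ω ∈ Ξ, smoothProj χ δ ω g z) = F := by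
    funext z
    rw [hF, sum_apply]
    simp only [hf, coe_schwartzProj]
  set B : Space d → ℤ → ℝ≥0∞ := fun ω k =>
    eLpNorm (fun t => ‖φ (δ ^ 2 * t - 1 / 2 - k)‖ₑ * sliceNorm r (f ω) t) q volume with hB
  have hlocal : ∀ k : ℤ, eLpNorm (sliceNorm r F) q
      (volume.restrict (Set.Icc (k * L) (k * L + L))) ≤ D * ell2 Ξ fun ω => B ω k := fun k => by
    have h1 := local_decoupling_of_lt hD hΞ _ (hasFourierSupport_timeShift hg (k * L))
    simp only [schwartzProj_timeShift] at h1
    rw [ell2_congr fun ω _ => mixedNorm_weightMul_timeShift φ hδ q r k _] at h1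
    have h2 : (fun z => ∑ ω ∈ Ξ, smoothProj χ δ ω (timeShift (k * L) g) z) =
        timeShift (k * L) F := by
      funext z
      simp only [timeShift_apply, ← coe_schwartzProj, schwartzProj_timeShift, hF, hf, sum_apply]
    rwa [h2, mixedNorm_timeShift_Icc] at h1
  -- The closed tiles share endpoints; domination of Lebesgue measure by the sum is all that is
  -- needed.
  have hcover : (volume : Measure ℝ) ≤
      Measure.sum fun k : ℤ => volume.restrict (Set.Icc (k * L) (k * L + L)) := by
    have hU : ⋃ k : ℤ, Set.Icc (k * L) (k * L + L) = Set.univ := by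
      have := iUnion_Icc_add_zsmul hL 0
      simpa [add_mul] using this
    calc (volume : Measure ℝ) = volume.restrict (⋃ k : ℤ, Set.Icc (k * L) (k * L + L)) := by
          rw [hU, Measure.restrict_univ]
      _ ≤ _ := Measure.restrict_iUnion_le
  calc mixedNorm q r Set.univ (fun z => ∑ ω ∈ Ξ, smoothProj χ δ ω g z)
      = eLpNorm (sliceNorm r F) q volume := by
        rw [hFc, mixedNorm, Measure.restrict_univ]; rfl
    _ ≤ eLpNorm (fun k : ℤ => eLpNorm (sliceNorm r F) q
          (volume.restrict (Set.Icc (k * L) (k * L + L)))) q Measure.count :=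
        (eLpNorm_mono_measure _ hcover).trans
          (eLpNorm_sum_measure_le _ _ (zero_lt_one.trans_le hq1).ne')
    _ ≤ D * eLpNorm (fun k => ell2 Ξ fun ω => B ω k) q Measure.count :=
        eLpNorm_le_mul_eLpNorm_of_ae_le_mul' (Filter.Eventually.of_forall fun k => by
          simpa using hlocal k) q
    _ ≤ D * ell2 Ξ fun ω => eLpNorm (B ω) q Measure.count :=
        mul_le_mul' le_rfl (eLpNorm_ell2_le Ξ (fun ω => Measurable.of_discrete) hq)
    _ ≤ D * ((C + 1 : ℝ≥0) * ell2 Ξ fun ω => mixedNorm q r Set.univ (smoothProj χ δ ω g)) := by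
        refine mul_le_mul' le_rfl (ell2_le_mul fun ω _ => ?_)
        have h1 := eLpNorm_count_mul_le (N := sliceNorm r (f ω))
          (measurable_sliceNorm r (f ω).continuous)
          (W := fun k t => ‖φ (δ ^ 2 * t - 1 / 2 - k)‖ₑ)
          (fun k => (φ.continuous.comp (by fun_prop)).enorm.measurable)
          (fun t => hC (δ ^ 2 * t - 1 / 2)) hq1
        refine h1.trans (mul_le_mul' (by simp) (le_of_eq ?_))
        rw [mixedNorm, Measure.restrict_univ, ← coe_schwartzProj]
        rfl
    _ = _ := by ring

/-! ### Existence of a time weight -/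

/-- Schwartz functions with compactly supported Fourier transform that are real, even and
bounded below near the origin. -/
theorem exists_schwartz_fourier_pos : ∃ (f : 𝓢(ℝ, ℂ)) (c : ℝ), 0 < c ∧ (∀ t, (f t).im = 0) ∧
    (∀ t, f (-t) = f t) ∧ (∀ t, |t| ≤ 1 → c ≤ (f t).re) ∧ ∀ s, 1 / 4 < |s| → 𝓕 f s = 0 := by
  -- With outer radius `1/8`, the phase `2πxt` stays below `π/3` for `|t| ≤ 1`, so its cosine is at
  -- least `1/2`.
  let B : ContDiffBump (0 : ℝ) := ⟨1 / 16, 1 / 8, by norm_num, by norm_num⟩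
  let β : 𝓢(ℝ, ℂ) :=
    (B.hasCompactSupport.toSchwartzMap B.contDiff).postcompCLM Complex.ofRealCLM
  have hβ : ∀ x, β x = (B x : ℂ) := fun x => rfl
  have hval : ∀ t, 𝓕 β t = ∫ x : ℝ, (Real.fourierChar (-(x * t)) : ℂ) * (B x : ℂ) := fun t => by
    rw [SchwartzMap.fourier_coe, Real.fourier_real_eq]
    simp only [Circle.smul_def, smul_eq_mul, hβ]
  have heven : ∀ t, 𝓕 β (-t) = 𝓕 β t := fun t => by
    rw [hval, hval, ← integral_neg_eq_self]
    simp only [neg_mul_neg, B.neg]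
  have hconj : ∀ t, (starRingEnd ℂ) (𝓕 β t) = 𝓕 β t := fun t => by
    conv_rhs => rw [← heven]
    rw [hval, hval, ← integral_conj]
    refine integral_congr_ae (Filter.Eventually.of_forall fun x => ?_)
    simp only [map_mul, Complex.conj_ofReal, mul_neg, neg_neg]
    rw [← Circle.coe_inv_eq_conj, ← AddChar.map_neg_eq_inv, neg_neg]
  have hBint : Integrable fun x : ℝ => B x := B.continuous.integrable_of_hasCompactSupport
    B.hasCompactSupport
  have hpos : 0 < ∫ x : ℝ, B x := B.integral_pos
  refine ⟨𝓕 β, 1 / 2 * ∫ x : ℝ, B x, by positivity,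
    fun t => Complex.conj_eq_iff_im.1 (hconj t), heven, fun t ht => ?_, fun s hs => ?_⟩
  · have hint : Integrable fun x : ℝ => (Real.fourierChar (-(x * t)) : ℂ) * (B x : ℂ) :=
      hBint.ofReal.bdd_mul (c := 1)
        (Continuous.aestronglyMeasurable (by
          have := Real.continuous_fourierChar
          fun_prop))
        (Filter.Eventually.of_forall fun x => by rw [Circle.norm_coe])
    have hre : (𝓕 β t).re =
        ∫ x : ℝ, ((Real.fourierChar (-(x * t)) : ℂ) * (B x : ℂ)).re := by
      rw [hval]
      exact (integral_re hint).symm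
    rw [hre, ← integral_const_mul]
    refine integral_mono (hBint.const_mul _) hint.re fun x => ?_
    simp only [Complex.re_mul_ofReal]
    by_cases hx : |x| < 1 / 8
    · refine mul_le_mul_of_nonneg_right ?_ B.nonneg
      rw [Real.fourierChar_apply, Complex.exp_ofReal_mul_I_re]
      have h1 : |2 * Real.pi * -(x * t)| ≤ Real.pi / 3 := by
        rw [abs_mul (2 * Real.pi), abs_neg, abs_mul x, abs_of_pos Real.two_pi_pos]
        have : |x| * |t| ≤ 1 / 8 * 1 := mul_le_mul hx.le ht (abs_nonneg _) (by norm_num)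
        nlinarith [Real.pi_pos]
      rw [← Real.cos_abs, ← Real.cos_pi_div_three]
      exact Real.cos_le_cos_of_nonneg_of_le_pi (abs_nonneg _) (by linarith [Real.pi_pos]) h1
    · rw [B.zero_of_le_dist (by simpa [B] using not_lt.1 hx)]
      simp
  · have h1 : 𝓕 (𝓕 β : 𝓢(ℝ, ℂ)) s = β (-s) := by
      conv_rhs => rw [← FourierTransform.fourierInv_fourier_eq (F := 𝓢(ℝ, ℂ)) β]
      rw [SchwartzMap.fourierInv_coe, Real.fourierInv_eq_fourier_neg, neg_neg,
        SchwartzMap.fourier_coe (𝓕 β)]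
    rw [h1, hβ, B.zero_of_le_dist]
    · simp
    · have : (1 / 8 : ℝ) ≤ |s| := by linarith
      simpa [B] using this

/-- Admissible time weights exist. -/
theorem exists_isTimeWeight : ∃ φ : 𝓢(ℝ, ℝ), IsTimeWeight φ := by
  obtain ⟨f, c, hc, him, heven, hlow, hsupp⟩ := exists_schwartz_fourier_pos
  let ρ : 𝓢(ℝ, ℝ) := f.postcompCLM Complex.reCLM
  have hρ : ∀ t, ρ t = (f t).re := fun t => rfl
  have hfρ : ∀ t, f t = (ρ t : ℂ) := fun t => Complex.ext (by simp [hρ]) (by simp [him])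
  -- Squaring gives nonnegativity everywhere, and dividing by `c²` gives `φ ≥ 1` on `[-1, 1]`. The
  -- spectrum only doubles, staying inside `[-1, 1]`.
  let φ : 𝓢(ℝ, ℝ) := (c ^ 2)⁻¹ • SchwartzMap.smulLeftCLM ℝ ρ ρ
  have hφ : ∀ t, φ t = (c ^ 2)⁻¹ * (ρ t * ρ t) := fun t => by
    simp [φ, SchwartzMap.smulLeftCLM_apply_apply ρ.hasTemperateGrowth]
  refine ⟨φ, fun t => by simp only [hφ, hρ, heven], fun t => ?_, fun s hs => ?_⟩
  · rw [hφ]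
    by_cases ht : t ∈ Set.Icc (-1 : ℝ) 1
    · rw [Set.indicator_of_mem ht, Pi.one_apply, inv_mul_eq_div, one_le_div (by positivity), pow_two]
      have := hlow t (abs_le.2 ht)
      rw [← hρ] at this
      exact mul_self_le_mul_self hc.le this
    · rw [Set.indicator_of_notMem ht]
      have := mul_self_nonneg (ρ t)
      positivity
  · by_contra hcon
    have hs1 : 1 < |s| := by
      by_contra h
      exact hcon (abs_le.1 (not_lt.1 h))
    refine hs ?_
    have hfun : (fun t : ℝ => (φ t : ℂ)) =
        fun t => (((c ^ 2)⁻¹ : ℂ) • f) t * f (⟪(1 : ℝ), t⟫ + 0) := by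
      funext t
      simp [hφ, hfρ, mul_assoc]
    rw [hfun, fourier_mul_comp_affine ((((c ^ 2)⁻¹ : ℂ) • f).integrable)]
    refine integral_eq_zero_of_ae (Filter.Eventually.of_forall fun y => ?_)
    simp only [← SchwartzMap.fourier_coe, FourierTransform.fourier_smul, smul_apply, smul_eq_mul,
      mul_one, Pi.zero_apply]
    by_cases hy : 1 / 4 < |y|
    · rw [hsupp y hy]; ring
    · rw [hsupp (s - y)]
      · ring
      · have := abs_sub_abs_le_abs_sub s y
        linarith

end MixedDecoupling

end

theorem mainTheorem5 (d : ℕ) (hd : 1 ≤ d)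
    (χ : 𝓢(MixedDecoupling.SpaceTime d, ℂ)) (hχ : MixedDecoupling.IsCutoff χ) :
    (∀ φ : 𝓢(ℝ, ℝ), MixedDecoupling.IsTimeWeight φ →
      (∃ C : ℝ≥0, ∀ q r : ℝ≥0∞, 2 ≤ q → 1 ≤ r → ∀ δ : ℝ, 0 < δ → δ < 1 →
        MixedDecoupling.localConst χ φ q r δ ≤ C * MixedDecoupling.globalConst χ q r (2 * δ)) ∧
      (∀ q : ℝ≥0∞, 2 ≤ q → ∃ C : ℝ≥0, ∀ r : ℝ≥0∞, 1 ≤ r → ∀ δ : ℝ, 0 < δ → δ < 1 →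
        MixedDecoupling.globalConst χ q r δ ≤ C * MixedDecoupling.localConst χ φ q r δ) ∧
      (∀ q' q : ℝ≥0∞, 1 ≤ q' → q' < q →
        ∃ C : ℝ≥0, ∀ r : ℝ≥0∞, 1 ≤ r → ∀ δ : ℝ, 0 < δ → δ < 1 →
          MixedDecoupling.localConst χ φ q' r δ ≤ C * MixedDecoupling.localConst χ φ q r δ)) ∧
    (∀ q' q : ℝ≥0∞, 2 ≤ q' → q' < q →
      ∃ C : ℝ≥0, ∀ r : ℝ≥0∞, 1 ≤ r → ∀ δ : ℝ, 0 < δ → δ < 1 →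
        MixedDecoupling.globalConst χ q' r δ ≤
          C * MixedDecoupling.globalConst χ q r (2 * δ)) := by
  refine ⟨fun φ hφ => ⟨?_, fun q hq => ?_, fun p q hp hpq => ?_⟩, fun p q hp hpq => ?_⟩
  · obtain ⟨C, hC⟩ := MixedDecoupling.exists_localConst_le_globalConst hd hχ hφ
    exact ⟨C, fun q r hq hr δ hδ _ => hC q r (one_le_two.trans hq) hr δ hδ⟩
  · obtain ⟨C, hC⟩ := MixedDecoupling.exists_globalConst_le_localConst χ φ
    exact ⟨C, fun r _ δ hδ _ => hC q r hq δ hδ⟩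
  · obtain ⟨C, hC⟩ := MixedDecoupling.exists_localConst_le_localConst hd hχ hφ hp hpq
    exact ⟨C, fun r hr δ hδ _ => hC r hr δ hδ⟩
  -- The weight is auxiliary and fixed here: pass from global to local at exponent `p`, raise to `q`
  -- locally, and return to global at scale `2δ`.
  · obtain ⟨φ, hφ⟩ := MixedDecoupling.exists_isTimeWeight
    have hp1 : 1 ≤ p := one_le_two.trans hp
    obtain ⟨C₁, h₁⟩ := MixedDecoupling.exists_globalConst_le_localConst χ φ
    obtain ⟨C₂, h₂⟩ := MixedDecoupling.exists_localConst_le_localConst hd hχ hφ hp1 hpq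
    obtain ⟨C₃, h₃⟩ := MixedDecoupling.exists_localConst_le_globalConst hd hχ hφ
    refine ⟨C₁ * C₂ * C₃, fun r hr δ hδ _ => ?_⟩
    calc MixedDecoupling.globalConst χ p r δ
        ≤ C₁ * (C₂ * (C₃ * MixedDecoupling.globalConst χ q r (2 * δ))) :=
          (h₁ p r hp δ hδ).trans <| mul_le_mul' le_rfl <| (h₂ r hr δ hδ).trans <|
            mul_le_mul' le_rfl (h₃ q r (hp1.trans hpq.le) hr δ hδ)
      _ = _ := by push_cast; ring
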